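/- Let $q=p^s$ be a power of a prime $p$, let $\ell\ge 1$, and let $X$ be a smooth projective geometrically irreducible curve over $\mathbf F_{q^\ell}$ with function field $F$ (that is, $F/\mathbf F_{q^\ell}$ is a function field in one variable with full constant field $\mathbf F_{q^\ell}$, and the closed points of $X$ are the places of $F$). For a divisor $A$ on $X$, let $\Omega(A)=H^0(X,\Omega_X\otimes\mathcal O_X(-A))$ be the $\mathbf F_{q^\ell}$-space of rational differential forms $\omega$ with $v_P(\omega)\ge v_P(A)$ at every place $P$, and let $h^1(A)=\dim_{\mathbf F_{q^\ell}}\Omega(A)$, which is finite. The Cartier operator $\mathcal C$ on the rational differential forms of $X$ is defined by $$\mathcal C\big((f_0^p+f_1^p x+\cdots+f_{p-1}^p x^{p-1})\,dx\big)=f_{p-1}\,dx \qquad (f_0,\dots,f_{p-1}\in F),$$ where $x$ is a separating element of $F/\mathbf F_{q^\ell}$ (the result does not depend on $x$); put $\mathcal C_q=\mathcal C^{s}$. Let $P_1,\dots,P_n$ be distinct rational points of $X$, let $D=P_1+\cdots+P_n$, and let $G$ be a divisor on $X$ whose support contains none of the $P_i$. Let $\mathrm{res}_D(\omega)=(\mathrm{res}_{P_1}(\omega),\dots,\mathrm{res}_{P_n}(\omega))$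 and put $$C_\Omega(D,G)=\mathrm{res}_D\big(\Omega(G-D)\big)\subseteq\mathbf F_{q^\ell}^n,\qquad C_\Omega(D,G)_{|\mathbf F_q}=C_\Omega(D,G)\cap\mathbf F_q^n,$$ $$Car_q(D,G)=\mathrm{res}_D\big(\{\omega\in\Omega(G-D) : \mathcal C_q(\omega)=\omega\}\big).$$ Let $G_1$ be a divisor on $X$ such that $G\ge qG_1$ and $G\ge G_1$. Then $Car_q(D,G)$ is an $\mathbf F_q$-subspace of $C_\Omega(D,G)_{|\mathbf F_q}$, and $$\dim_{\mathbf F_q}\Big(C_\Omega(D,G)_{|\mathbf F_q}\big/Car_q(D,G)\Big)\le \ell\, h^1(G_1).$$ In particular, if $h^1(G_1)=0$, then $C_\Omega(D,G)_{|\mathbf F_q}=Car_q(D,G)$. -/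

import Mathlib

open scoped WithZero IntermediateField KaehlerDifferential

namespace AGCode

/-- `F` is the function field of a (smooth projective geometrically irreducible) curve over the
perfect field `K`: it is a finite extension of a rational function field `K(x)`, and `K` is
algebraically closed in `F`. -/
class IsCurveFunctionField (K F : Type*) [Field K] [Field F] [Algebra K F] : Prop where
  exists_finite : ∃ x : F, Transcendental K x ∧ FiniteDimensional K⟮x⟯ F
  algebraic_mem : ∀ y : F, IsAlgebraic K y → ∃ a : K, algebraMap K F a = y

/-- A place of `F / K` (a closed point of the curve), given by its local ring: a discrete
valuation ring of `F` that contains `K`. -/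
structure Place (K F : Type*) [Field K] [Field F] [Algebra K F] where
  localRing : ValuationSubring F
  algebraMap_mem : ∀ a : K, algebraMap K F a ∈ localRing
  isDVR : IsDiscreteValuationRing localRing

attribute [instance] Place.isDVR

/-- Divisors of the curve. -/
abbrev Divisor (K F : Type*) [Field K] [Field F] [Algebra K F] := Place K F →₀ ℤ

section

variable {K F : Type*} [Field K] [Field F] [Algebra K F]

namespace Place

/-- The normalised valuation at `P`, written multiplicatively: its value at `f ≠ 0` is
`WithZero.exp (-v_P(f))`. -/
noncomputable def valuation (P : Place K F) : Valuation F ℤᵐ⁰ :=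
  (IsDiscreteValuationRing.maximalIdeal P.localRing).valuation F

/-- `v_P(f) ≥ m` (true for `f = 0`). -/
def OrdGE (P : Place K F) (m : ℤ) (f : F) : Prop := P.valuation f ≤ WithZero.exp (-m)

/-- `v_P(t) = 1`. -/
def IsUniformizer (P : Place K F) (t : F) : Prop := P.valuation t = WithZero.exp (-1)

/-- The place is rational: the residue field at `P` is `K`. -/
def IsRational (P : Place K F) : Prop :=
  ∀ f ∈ P.localRing, ∃ a : K, P.OrdGE 1 (f - algebraMap K F a)

/-- `v_P(ω) ≥ m` for a rational differential `ω`: writing `ω = f dt` with `t` a uniformiser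
at `P`, one has `v_P(f) ≥ m`. This does not depend on `t`. -/
def DiffOrdGE (P : Place K F) (m : ℤ) (ω : Ω[F⁄K]) : Prop :=
  ∀ t : F, P.IsUniformizer t → ∃ f : F, P.OrdGE m f ∧ ω = f • KaehlerDifferential.D K F t

/-- `res_P(ω) = a` at a rational place `P`: writing `ω = f dt` with `t` a uniformiser at `P`, the
coefficient of `t⁻¹` in the Laurent expansion
`f = c_N t^(-N-1) + ⋯ + c_1 t^(-2) + c_0 t^(-1) + (regular at P)` is `c_0 = a`.
This does not depend on `t`. -/
def HasResidue (P : Place K F) (ω : Ω[F⁄K]) (a : K) : Prop :=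
  ∀ t : F, P.IsUniformizer t → ∃ (N : ℕ) (c : ℕ → K) (r : F), r ∈ P.localRing ∧
    ω = ((∑ i ∈ Finset.range (N + 1), algebraMap K F (c i) * (t ^ (i + 1))⁻¹) + r) •
      KaehlerDifferential.D K F t ∧ c 0 = a

lemma OrdGE.add {P : Place K F} {m : ℤ} {f g : F} (hf : P.OrdGE m f) (hg : P.OrdGE m g) :
    P.OrdGE m (f + g) := Valuation.map_add_le _ hf hg

lemma OrdGE.const_mul {P : Place K F} {m : ℤ} {f : F} (a : K) (hf : P.OrdGE m f) :
    P.OrdGE m (algebraMap K F a * f) := by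
  have h1 : P.valuation (algebraMap K F a) ≤ 1 :=
    (IsDiscreteValuationRing.maximalIdeal P.localRing).valuation_le_one
      (⟨algebraMap K F a, P.algebraMap_mem a⟩ : P.localRing)
  unfold OrdGE at *
  rw [map_mul]
  exact (mul_le_mul' h1 hf).trans_eq (one_mul _)

lemma HasResidue.add {P : Place K F} {ω η : Ω[F⁄K]} {a b : K} (hω : P.HasResidue ω a)
    (hη : P.HasResidue η b) : P.HasResidue (ω + η) (a + b) := by
  have pad : ∀ (t : F) (N M : ℕ) (c : ℕ → K),
      ∑ i ∈ Finset.range (N + M + 1), algebraMap K F (if i < N + 1 then c i else 0) *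
        (t ^ (i + 1))⁻¹ = ∑ i ∈ Finset.range (N + 1), algebraMap K F (c i) * (t ^ (i + 1))⁻¹ := by
    intro t N M c
    rw [← Finset.sum_subset (Finset.range_mono (by omega : N + 1 ≤ N + M + 1))]
    · refine Finset.sum_congr rfl fun i hi => ?_
      rw [if_pos (Finset.mem_range.1 hi)]
    · intro i _ hi
      rw [if_neg (by simpa using hi), map_zero, zero_mul]
  intro t ht
  obtain ⟨N, c, r, hr, h1, h2⟩ := hω t ht
  obtain ⟨M, d, s, hs, h3, h4⟩ := hη t ht
  refine ⟨N + M, fun i => (if i < N + 1 then c i else 0) + (if i < M + 1 then d i else 0), r + s,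
    add_mem hr hs, ?_, by simp [h2, h4]⟩
  have e1 := pad t N M c
  have e2 := pad t M N d
  rw [add_comm M N] at e2
  simp only [map_add, add_mul, Finset.sum_add_distrib]
  rw [e1, e2, h1, h3, ← add_smul]
  congr 1
  ring

lemma HasResidue.zero (P : Place K F) : P.HasResidue 0 0 :=
  fun _ _ => ⟨0, 0, 0, zero_mem _, by simp, rfl⟩

lemma HasResidue.smul {P : Place K F} {ω : Ω[F⁄K]} {a : K} (b : K) (hω : P.HasResidue ω a) :
    P.HasResidue (b • ω) (b * a) := by
  intro t ht
  obtain ⟨N, c, r, hr, h1, h2⟩ := hω t ht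
  refine ⟨N, fun i => b * c i, algebraMap K F b * r, mul_mem (P.algebraMap_mem b) hr, ?_,
    by simp [h2]⟩
  rw [h1, ← smul_assoc, Algebra.smul_def, mul_add, Finset.mul_sum]
  simp only [map_mul, mul_assoc]

end Place

/-- The space `Ω(A) = H⁰(X, Ω_X ⊗ O_X(-A))` of rational differentials `ω` with
`v_P(ω) ≥ A(P)` at every place `P`. -/
def diffSpace (A : Divisor K F) : Submodule K Ω[F⁄K] where
  carrier := {ω | ∀ P : Place K F, P.DiffOrdGE (A P) ω}
  add_mem' := by
    intro ω η hω hη P t ht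
    obtain ⟨f, hf, h1⟩ := hω P t ht
    obtain ⟨g, hg, h2⟩ := hη P t ht
    exact ⟨f + g, hf.add hg, by rw [h1, h2, add_smul]⟩
  zero_mem' := fun P t _ => ⟨0, by simp [Place.OrdGE], by simp⟩
  smul_mem' := by
    intro a ω hω P t ht
    obtain ⟨f, hf, h1⟩ := hω P t ht
    exact ⟨algebraMap K F a * f, hf.const_mul a, by
      rw [h1, ← smul_assoc, Algebra.smul_def]⟩

/-- `h¹(A) = dim_K Ω(A)`. -/
noncomputable def h1 (A : Divisor K F) : ℕ := Module.finrank K (diffSpace A)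

/-- The divisor `D = P_1 + ⋯ + P_n`. -/
noncomputable def pointDivisor {n : ℕ} (P : Fin n → Place K F) : Divisor K F :=
  ∑ i, Finsupp.single (P i) 1

/-- The code `C_Ω(D, G)`: the image of `Ω(G - D)` under `ω ↦ (res_{P_1} ω, …, res_{P_n} ω)`. -/
def residueCode {n : ℕ} (P : Fin n → Place K F) (G : Divisor K F) : Submodule K (Fin n → K) where
  carrier := {c | ∃ ω ∈ diffSpace (G - pointDivisor P), ∀ i, (P i).HasResidue ω (c i)}
  add_mem' := by
    rintro c d ⟨ω, hω, h1⟩ ⟨η, hη, h2⟩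
    exact ⟨ω + η, add_mem hω hη, fun i => (h1 i).add (h2 i)⟩
  zero_mem' := ⟨0, zero_mem _, fun i => Place.HasResidue.zero _⟩
  smul_mem' := by
    rintro a c ⟨ω, hω, h1⟩
    exact ⟨a • ω, Submodule.smul_mem _ a hω, fun i => (h1 i).smul a⟩

/-- The subfield subcode `C ∩ kⁿ`, inside `Kⁿ`, of a code `C` over `K`. -/
def subfieldSubcode (k : Type*) [Field k] [Algebra k K] {n : ℕ} (C : Submodule K (Fin n → K)) :
    Submodule k (Fin n → K) where
  carrier := {c | c ∈ C ∧ ∀ i, c i ∈ (algebraMap k K).range}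
  add_mem' := fun hc hd => ⟨add_mem hc.1 hd.1, fun i => add_mem (hc.2 i) (hd.2 i)⟩
  zero_mem' := ⟨zero_mem _, fun _ => zero_mem _⟩
  smul_mem' := by
    rintro a c ⟨hc, h⟩
    refine ⟨?_, fun i => ?_⟩
    · rw [← algebraMap_smul K a c]
      exact Submodule.smul_mem _ _ hc
    · rw [Pi.smul_apply, Algebra.smul_def]
      exact mul_mem ⟨a, rfl⟩ (h i)

/-- `x` is a separating element of `F / K`. -/
def IsSeparating (K : Type*) {F : Type*} [Field K] [Field F] [Algebra K F] (x : F) : Prop :=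
  Transcendental K x ∧ Algebra.IsSeparable K⟮x⟯ F

/-- The graph of the Cartier operator `𝒞` in characteristic `p`: `𝒞(ω) = η` when, writing
`ω = (f_0^p + f_1^p x + ⋯ + f_{p-1}^p x^{p-1}) dx` with `x` a separating element, one has
`η = f_{p-1} dx`. This does not depend on `x`. -/
def IsCartier (p : ℕ) (ω η : Ω[F⁄K]) : Prop :=
  ∀ x : F, IsSeparating K x → ∃ f : ℕ → F,
    ω = (∑ i ∈ Finset.range p, f i ^ p * x ^ i) • KaehlerDifferential.D K F x ∧
    η = f (p - 1) • KaehlerDifferential.D K F x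

/-- The graph of the `s`-fold iterate of the Cartier operator. -/
def IsCartierIter (p : ℕ) : ℕ → Ω[F⁄K] → Ω[F⁄K] → Prop
  | 0, ω, η => ω = η
  | s + 1, ω, η => ∃ θ, IsCartier p ω θ ∧ IsCartierIter p s θ η

lemma IsCartier.add {p : ℕ} [Fact p.Prime] [CharP F p] {ω ω' η η' : Ω[F⁄K]}
    (h : IsCartier p ω η) (h' : IsCartier p ω' η') : IsCartier p (ω + ω') (η + η') := by
  intro x hx
  obtain ⟨f, h1, h2⟩ := h x hx
  obtain ⟨g, h3, h4⟩ := h' x hx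
  refine ⟨f + g, ?_, ?_⟩
  · rw [h1, h3, ← add_smul, ← Finset.sum_add_distrib]
    simp only [Pi.add_apply, add_pow_char, add_mul]
  · rw [h2, h4, ← add_smul, Pi.add_apply]

lemma IsCartier.smul {p : ℕ} {ω η : Ω[F⁄K]} (b : K) (h : IsCartier p ω η) :
    IsCartier p (b ^ p • ω) (b • η) := by
  intro x hx
  obtain ⟨f, h1, h2⟩ := h x hx
  refine ⟨fun i => algebraMap K F b * f i, ?_, ?_⟩
  · rw [h1, ← smul_assoc, Algebra.smul_def, Finset.mul_sum]
    simp only [map_pow, mul_pow, mul_assoc]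
  · rw [h2, ← smul_assoc, Algebra.smul_def]

lemma IsCartier.zero {p : ℕ} (hp : p ≠ 0) : IsCartier p (0 : Ω[F⁄K]) 0 :=
  fun _ _ => ⟨0, by simp [hp], by simp⟩

lemma IsCartierIter.add {p : ℕ} [Fact p.Prime] [CharP F p] : ∀ {s : ℕ} {ω ω' η η' : Ω[F⁄K]},
    IsCartierIter p s ω η → IsCartierIter p s ω' η' → IsCartierIter p s (ω + ω') (η + η')
  | 0, _, _, _, _, h, h' => congrArg₂ (· + ·) h h'
  | _ + 1, _, _, _, _, ⟨θ, h1, h2⟩, ⟨θ', h3, h4⟩ => ⟨θ + θ', h1.add h3, h2.add h4⟩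

lemma IsCartierIter.smul {p : ℕ} (b : K) : ∀ {s : ℕ} {ω η : Ω[F⁄K]},
    IsCartierIter p s ω η → IsCartierIter p s (b ^ p ^ s • ω) (b • η)
  | 0, ω, η, h => by
    rw [pow_zero, pow_one]
    exact congrArg (b • ·) h
  | s + 1, _, _, ⟨θ, h1, h2⟩ => by
    refine ⟨b ^ p ^ s • θ, ?_, h2.smul b⟩
    rw [pow_succ, pow_mul]
    exact h1.smul _

lemma IsCartierIter.zero {p : ℕ} (hp : p ≠ 0) : ∀ s : ℕ, IsCartierIter p s (0 : Ω[F⁄K]) 0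
  | 0 => rfl
  | s + 1 => ⟨0, IsCartier.zero hp, IsCartierIter.zero hp s⟩

/-- The Cartier code `Car_q(D, G)`, where `q = #k = p ^ s`: the image, in `Kⁿ`, of the space of
all `ω ∈ Ω(G - D)` with `𝒞_q(ω) = ω` under `ω ↦ (res_{P_1} ω, …, res_{P_n} ω)`; here
`𝒞_q = 𝒞 ^ s`. -/
def cartierCode (k : Type*) [Field k] [Algebra k K] [Finite k] {p s : ℕ} [Fact p.Prime]
    [CharP F p] (hq : Nat.card k = p ^ s) {n : ℕ} (P : Fin n → Place K F) (G : Divisor K F) :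
    Submodule k (Fin n → K) where
  carrier := {c | ∃ ω ∈ diffSpace (G - pointDivisor P), IsCartierIter p s ω ω ∧
    ∀ i, (P i).HasResidue ω (c i)}
  add_mem' := by
    rintro c d ⟨ω, hω, h1, h2⟩ ⟨η, hη, h3, h4⟩
    exact ⟨ω + η, add_mem hω hη, h1.add h3, fun i => (h2 i).add (h4 i)⟩
  zero_mem' := ⟨0, zero_mem _, IsCartierIter.zero (Fact.out : p.Prime).ne_zero s,
    fun i => Place.HasResidue.zero _⟩
  smul_mem' := by
    rintro a c ⟨ω, hω, h1, h2⟩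
    refine ⟨algebraMap k K a • ω, Submodule.smul_mem _ _ hω, ?_, fun i => ?_⟩
    · have h := h1.smul (algebraMap k K a)
      have ha : a ^ p ^ s = a := by
        have := Fintype.ofFinite k
        rw [← hq, Nat.card_eq_fintype_card, FiniteField.pow_card]
      rwa [← map_pow, ha] at h
    · rw [Pi.smul_apply, Algebra.smul_def]
      exact (h2 i).smul _

end

end AGCode

/-! Apply `𝒞_q - 1` to a form `ω ∈ Ω(G - D)` with residues in `𝔽_q`. The operator `𝒞` divides orders
by `p`, rounding in the favourable direction, so outside `D` the condition `G ≥ qG₁` bounds `𝒞_q ω`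
by `G₁`, and `G ≥ G₁` does the same for `ω`. At `P_i` both forms have at most a simple pole, and
`res(𝒞_q ω)^q = res(ω)`. Since `res(ω) = res(ω)^q`, injectivity of Frobenius makes the two residues
equal, so the poles cancel, and a regular form is enough because `G₁(P_i) ≤ G(P_i) = 0`. Thus `𝒞_q -
1` maps into `Ω(G₁)`, of `𝔽_q`-dimension `ℓ h¹(G₁)`. It is `𝔽_q`-linear, and the residues of its
kernel lie in `Car_q(D, G)`, which gives the bound. The inclusion of codes is the same residue
formula: a fixed form has residues with `c^q = c`.

Two foundations support this. Since `[F : F^p] = p`, any `y` that is not a `p`-th power gives a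
basis `1, …, y^(p-1)` of `F` over `F^p`, and `𝒞` may be computed with any such `y`
(`IsCartierAt.change`); the key identity is `𝒞(f^(p-1) df) = df`. In particular a uniformiser `t`
can be used. The terms of `∑ aᵢ^p t^i` have orders distinct modulo `p`, so they cannot cancel, and
orders and residues are read off termwise (`DiffOrdGE.cartier`, `HasSimpleResidue.cartier`).

The second is finiteness of `Ω(A)` (`finiteDimensional_diffSpace`), indispensable because `h1` is a
`finrank`, which is `0` on infinite-dimensional spaces. Imposing one more zero costs a finite
dimension, and once there are enough zeros a form is `dx` times a function without poles, that is, a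
constant. -/

namespace AGCode

/-! ### Bases of `F` over its `p`-th powers -/

section PBasis

variable {K F : Type*} [Field K] [Field F] [Algebra K F]

theorem essFiniteType_of_isCurveFunctionField [IsCurveFunctionField K F] :
    Algebra.EssFiniteType K F := by
  obtain ⟨x, -, hx⟩ := IsCurveFunctionField.exists_finite (K := K) (F := F)
  have : Algebra.EssFiniteType K K⟮x⟯ := by
    rw [IntermediateField.essFiniteType_iff]
    exact ⟨{x}, by simp⟩
  exact Algebra.EssFiniteType.comp K K⟮x⟯ F

theorem IsSeparating.finiteDimensional [IsCurveFunctionField K F] {x : F}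
    (hx : IsSeparating K x) : FiniteDimensional K⟮x⟯ F := by
  have := essFiniteType_of_isCurveFunctionField (K := K) (F := F)
  have := hx.2
  have := Algebra.EssFiniteType.of_comp K K⟮x⟯ F
  have := Algebra.FormallyUnramified.of_isSeparable K⟮x⟯ F
  exact Algebra.FormallyUnramified.finite_of_free K⟮x⟯ F

/-- A finite field is perfect, so a separating transcendence basis exists; comparison with the given
`x` shows that it has one element. -/
theorem exists_isSeparating [Finite K] [IsCurveFunctionField K F] :
    ∃ x : F, IsSeparating K x := by
  have hF := essFiniteType_of_isCurveFunctionField (K := K) (F := F)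
  obtain ⟨x, hx, hfin⟩ := IsCurveFunctionField.exists_finite (K := K) (F := F)
  obtain ⟨s, hs, hsep⟩ := exists_isTranscendenceBasis_and_isSeparable_of_perfectField K F
  have hx' : IsTranscendenceBasis K (fun _ : Unit => x) := by
    have h1 : AlgebraicIndependent K (fun _ : Unit => x) :=
      (algebraicIndependent_unique_type_iff (ι := Unit)).2 hx
    refine h1.isTranscendenceBasis_iff_isAlgebraic.2 ?_
    rw [Set.range_const]
    have : Algebra.IsAlgebraic K⟮x⟯ F := inferInstance
    exact IntermediateField.isAlgebraic_adjoin_iff_top.1 this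
  have hc := hs.lift_cardinalMk_eq hx'
  have hcard : s.card = 1 := by
    simpa using hc
  obtain ⟨y, rfl⟩ := Finset.card_eq_one.1 hcard
  refine ⟨y, ?_, by rwa [Finset.coe_singleton] at hsep⟩
  exact hs.1.transcendental ⟨y, by simp⟩

/-- The differentials of `F / K` do not vanish identically. -/
theorem not_subsingleton_kaehlerDifferential [IsCurveFunctionField K F] :
    ¬ Subsingleton Ω[F⁄K] := by
  intro h
  have := essFiniteType_of_isCurveFunctionField (K := K) (F := F)
  -- An unramified extension essentially of finite type is finite, which a transcendental element
  -- forbids.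
  have : Algebra.FormallyUnramified K F := ⟨h⟩
  have := Algebra.FormallyUnramified.finite_of_free K F
  obtain ⟨x, hx, -⟩ := IsCurveFunctionField.exists_finite (K := K) (F := F)
  exact hx (Algebra.IsAlgebraic.isAlgebraic x)

theorem derivation_pow_char {p : ℕ} [CharP F p] (f : F) :
    KaehlerDifferential.D K F (f ^ p) = 0 := by
  rw [Derivation.leibniz_pow, ← Nat.cast_smul_eq_nsmul F, CharP.cast_eq_zero, zero_smul]

theorem charP_of_charP_algebra (K : Type*) {F : Type*} [Field K] [Field F] [Algebra K F] (p : ℕ)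
    [CharP F p] : CharP K p :=
  (RingHom.charP_iff (algebraMap K F) (algebraMap K F).injective p).2 inferInstance

variable {p : ℕ} [Fact p.Prime] [CharP F p]

theorem exists_pow_char_eq [Finite K] (p : ℕ) [Fact p.Prime] [CharP F p] (a : K) :
    ∃ b : K, b ^ p = a := by
  have := charP_of_charP_algebra K (F := F) p
  have : ExpChar K p := ExpChar.prime Fact.out
  exact surjective_frobenius K p a

/-- `F` is separable over `F^p(x)`, which contains `K(x)` because `K = K^p`, and purely inseparable
over it, because it contains `F^p`. Hence the two coincide. -/
theorem IsSeparating.adjoin_frobenius_eq_top [Finite K] {x : F} (hx : IsSeparating K x) :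
    IntermediateField.adjoin (frobenius F p).fieldRange {x} = ⊤ := by
  set E := (frobenius F p).fieldRange
  set M := IntermediateField.adjoin E {x}
  have hK : ∀ a : K, algebraMap K F a ∈ M.toSubfield := by
    intro a
    obtain ⟨b, rfl⟩ := exists_pow_char_eq (F := F) p a
    rw [map_pow]
    exact M.algebraMap_mem ⟨_, ⟨algebraMap K F b, rfl⟩⟩
  have hle : K⟮x⟯ ≤ M.toSubfield.toIntermediateField hK := by
    rw [IntermediateField.adjoin_simple_le_iff]
    exact IntermediateField.mem_adjoin_simple_self E x
  have := hx.2
  let i : K⟮x⟯ →+* M :=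
    { toFun := fun z => ⟨z, hle z.2⟩
      map_one' := rfl
      map_mul' := fun _ _ => rfl
      map_zero' := rfl
      map_add' := fun _ _ => rfl }
  let _ : Algebra K⟮x⟯ M := i.toAlgebra
  have : IsScalarTower K⟮x⟯ M F := IsScalarTower.of_algebraMap_eq fun _ => rfl
  have h1 : Algebra.IsSeparable M F := Algebra.isSeparable_tower_top_of_isSeparable K⟮x⟯ M F
  have : CharP M p := charP_of_charP_algebra M (F := F) p
  have : ExpChar M p := ExpChar.prime Fact.out
  have h2 : IsPurelyInseparable M F := by
    rw [isPurelyInseparable_iff_pow_mem M p]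
    exact fun y => ⟨1, ⟨⟨y ^ p, M.algebraMap_mem ⟨_, ⟨y, rfl⟩⟩⟩, by simp⟩⟩
  have h3 := (IsPurelyInseparable.bijective_algebraMap_of_isSeparable M F).2
  rw [eq_top_iff]
  intro y _
  obtain ⟨z, rfl⟩ := h3 y
  exact z.2

/-- Otherwise `F = F^p(x) = F^p`, and every differential would vanish. -/
theorem IsSeparating.pow_ne [Finite K] [IsCurveFunctionField K F] {x : F}
    (hx : IsSeparating K x) (z : F) : z ^ p ≠ x := by
  intro hz
  have h := hx.adjoin_frobenius_eq_top (p := p)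
  have hbot : IntermediateField.adjoin (frobenius F p).fieldRange {x} = ⊥ := by
    rw [IntermediateField.adjoin_simple_eq_bot_iff]
    exact IntermediateField.algebraMap_mem ⊥ (⟨x, ⟨z, hz⟩⟩ : (frobenius F p).fieldRange)
  have hall : ∀ y : F, ∃ w : F, w ^ p = y := by
    intro y
    have hy : y ∈ IntermediateField.adjoin (frobenius F p).fieldRange {x} := h ▸ trivial
    rw [hbot] at hy
    obtain ⟨⟨_, w, rfl⟩, rfl⟩ := hy
    exact ⟨w, rfl⟩
  refine not_subsingleton_kaehlerDifferential (K := K) (F := F) ?_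
  rw [← Submodule.subsingleton_iff F, ← subsingleton_iff_bot_eq_top,
    ← KaehlerDifferential.span_range_derivation, eq_comm, Submodule.span_eq_bot]
  rintro _ ⟨y, rfl⟩
  obtain ⟨w, rfl⟩ := hall y
  exact derivation_pow_char w

theorem isIntegral_frobenius_fieldRange (y : F) : IsIntegral (frobenius F p).fieldRange y := by
  refine ⟨Polynomial.X ^ p - Polynomial.C ⟨y ^ p, ⟨y, rfl⟩⟩,
    Polynomial.monic_X_pow_sub_C _ (Fact.out : p.Prime).ne_zero, ?_⟩
  simp only [Polynomial.eval₂_sub, Polynomial.eval₂_pow, Polynomial.eval₂_X, Polynomial.eval₂_C]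
  exact sub_self _

theorem natDegree_minpoly_frobenius_fieldRange {y : F} (hy : ∀ z : F, z ^ p ≠ y) :
    (minpoly (frobenius F p).fieldRange y).natDegree = p := by
  have hirr : Irreducible (Polynomial.X ^ p - Polynomial.C
      (⟨y ^ p, ⟨y, rfl⟩⟩ : (frobenius F p).fieldRange)) := by
    refine X_pow_sub_C_irreducible_of_prime Fact.out fun b hb => ?_
    obtain ⟨_, w, rfl⟩ := b
    have h : (frobenius F p) (w ^ p) = frobenius F p y := congrArg Subtype.val hb
    exact hy w ((frobenius F p).injective h)
  rw [← minpoly.eq_of_irreducible_of_monic (x := y) hirr (by simp; exact sub_self _)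
    (Polynomial.monic_X_pow_sub_C _ (Fact.out : p.Prime).ne_zero), Polynomial.natDegree_X_pow_sub_C]

theorem finrank_frobenius_fieldRange (K : Type*) {F : Type*} [Field K] [Field F] [Algebra K F]
    {p : ℕ} [Fact p.Prime] [CharP F p] [Finite K] [IsCurveFunctionField K F] :
    Module.finrank (frobenius F p).fieldRange F = p := by
  obtain ⟨x, hx⟩ := exists_isSeparating (K := K) (F := F)
  rw [← IntermediateField.finrank_top', ← hx.adjoin_frobenius_eq_top (p := p),
    IntermediateField.adjoin.finrank (isIntegral_frobenius_fieldRange x),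
    natDegree_minpoly_frobenius_fieldRange hx.pow_ne]

theorem linearIndependent_frobenius_pow {y : F} (hy : ∀ z : F, z ^ p ≠ y) :
    LinearIndependent (frobenius F p).fieldRange (fun i : Fin p => y ^ (i : ℕ)) := by
  have h := linearIndependent_pow (K := (frobenius F p).fieldRange) y
  rwa [natDegree_minpoly_frobenius_fieldRange hy] at h

/-- If `y` is not a `p`-th power, its powers `1, y, …, y ^ (p - 1)` span `F` over the subfield of
`p`-th powers. -/
theorem exists_eq_sum_pow_mul_pow (K : Type*) {F : Type*} [Field K] [Field F] [Algebra K F]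
    {p : ℕ} [Fact p.Prime] [CharP F p] [Finite K] [IsCurveFunctionField K F]
    {y : F} (hy : ∀ z : F, z ^ p ≠ y) (f : F) :
    ∃ a : ℕ → F, f = ∑ i ∈ Finset.range p, a i ^ p * y ^ i := by
  have hp : p.Prime := Fact.out
  have : Nonempty (Fin p) := ⟨⟨0, hp.pos⟩⟩
  have hspan := (linearIndependent_frobenius_pow hy).span_eq_top_of_card_eq_finrank
    (by rw [finrank_frobenius_fieldRange K, Fintype.card_fin])
  have hf : f ∈ Submodule.span (frobenius F p).fieldRange
    (Set.range fun i : Fin p => y ^ (i : ℕ)) := hspan ▸ trivial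
  obtain ⟨c, rfl⟩ := (Submodule.mem_span_range_iff_exists_fun _).1 hf
  choose w hw using fun i => (c i).2
  refine ⟨fun i => if h : i < p then w ⟨i, h⟩ else 0, ?_⟩
  rw [← Fin.sum_univ_eq_sum_range
    (fun i => (if h : i < p then w ⟨i, h⟩ else 0) ^ p * y ^ i) p]
  refine Finset.sum_congr rfl fun i _ => ?_
  rw [dif_pos i.2, Subfield.smul_def, smul_eq_mul, ← hw i]
  rfl

theorem coeff_eq_of_sum_pow_mul_pow_eq {y : F} (hy : ∀ z : F, z ^ p ≠ y) {a b : ℕ → F}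
    (h : ∑ i ∈ Finset.range p, a i ^ p * y ^ i = ∑ i ∈ Finset.range p, b i ^ p * y ^ i)
    {i : ℕ} (hi : i < p) : a i = b i := by
  have hli := linearIndependent_frobenius_pow hy
  rw [Fintype.linearIndependent_iffₛ] at hli
  have := hli (fun i => ⟨a i ^ p, ⟨a i, rfl⟩⟩) (fun i => ⟨b i ^ p, ⟨b i, rfl⟩⟩) (by
    simp only [Subfield.smul_def, smul_eq_mul]
    rw [Fin.sum_univ_eq_sum_range (fun i => a i ^ p * y ^ i) p,
      Fin.sum_univ_eq_sum_range (fun i => b i ^ p * y ^ i) p, h]) ⟨i, hi⟩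
  exact (frobenius F p).injective (congrArg Subtype.val this)

theorem derivation_sum_pow_mul_pow {p : ℕ} [CharP F p] (a : ℕ → F) (y : F) :
    KaehlerDifferential.D K F (∑ i ∈ Finset.range p, a i ^ p * y ^ i) =
      (∑ i ∈ Finset.range p, a i ^ p * (i * y ^ (i - 1))) • KaehlerDifferential.D K F y := by
  rw [map_sum, Finset.sum_smul]
  refine Finset.sum_congr rfl fun i _ => ?_
  rw [Derivation.leibniz, derivation_pow_char (p := p) (a i), smul_zero, add_zero,
    Derivation.leibniz_pow, ← Nat.cast_smul_eq_nsmul F, smul_smul, smul_smul, mul_assoc]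

variable [Finite K] [IsCurveFunctionField K F]

/-- In the expansion of `f` in powers of `y` the coefficients are `p`-th powers, hence constants for
`d`; so `df` is a multiple of `dy`. -/
theorem exists_eq_smul_derivation {y : F} (hy : ∀ z : F, z ^ p ≠ y) (ω : Ω[F⁄K]) :
    ∃ f : F, ω = f • KaehlerDifferential.D K F y := by
  have h : ω ∈ Submodule.span F {KaehlerDifferential.D K F y} := by
    have : Submodule.span F (Set.range (KaehlerDifferential.D K F)) ≤
        Submodule.span F {KaehlerDifferential.D K F y} := by
      rw [Submodule.span_le]
      rintro _ ⟨f, rfl⟩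
      obtain ⟨a, rfl⟩ := exists_eq_sum_pow_mul_pow K hy f
      rw [derivation_sum_pow_mul_pow]
      exact Submodule.smul_mem _ _ (Submodule.mem_span_singleton_self _)
    rw [KaehlerDifferential.span_range_derivation] at this
    exact this trivial
  obtain ⟨f, rfl⟩ := Submodule.mem_span_singleton.1 h
  exact ⟨f, rfl⟩

theorem derivation_ne_zero {y : F} (hy : ∀ z : F, z ^ p ≠ y) :
    KaehlerDifferential.D K F y ≠ 0 := by
  intro h0
  refine not_subsingleton_kaehlerDifferential (K := K) (F := F) ⟨fun ω η => ?_⟩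
  obtain ⟨f, rfl⟩ := exists_eq_smul_derivation hy ω
  obtain ⟨g, rfl⟩ := exists_eq_smul_derivation hy η
  simp [h0]

theorem smul_derivation_inj {y : F} (hy : ∀ z : F, z ^ p ≠ y) {f g : F}
    (h : f • KaehlerDifferential.D K F y = g • KaehlerDifferential.D K F y) : f = g :=
  smul_left_injective F (derivation_ne_zero hy) h

end PBasis

/-! ### The Cartier operator and its independence of the element -/

section Cartier

variable {K F : Type*} [Field K] [Field F] [Algebra K F]

/-- The graph of the Cartier operator, computed with the element `y`. -/
def IsCartierAt (p : ℕ) (y : F) (ω η : Ω[F⁄K]) : Prop :=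
  ∃ f : ℕ → F,
    ω = (∑ i ∈ Finset.range p, f i ^ p * y ^ i) • KaehlerDifferential.D K F y ∧
    η = f (p - 1) • KaehlerDifferential.D K F y

variable {p : ℕ} [Fact p.Prime] [CharP F p] {y : F} {ω ω' η η' : Ω[F⁄K]}

theorem natCast_pow_char (n : ℕ) : (n : F) ^ p = n :=
  map_natCast (frobenius F p) n

namespace IsCartierAt

theorem add (h : IsCartierAt p y ω η) (h' : IsCartierAt p y ω' η') :
    IsCartierAt p y (ω + ω') (η + η') := by
  obtain ⟨f, rfl, rfl⟩ := h
  obtain ⟨g, rfl, rfl⟩ := h'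
  refine ⟨f + g, ?_, ?_⟩
  · rw [← add_smul, ← Finset.sum_add_distrib]
    simp only [Pi.add_apply, add_pow_char, add_mul]
  · rw [← add_smul, Pi.add_apply]

theorem pow_smul {p : ℕ} {y : F} {ω η : Ω[F⁄K]} (g : F) (h : IsCartierAt p y ω η) :
    IsCartierAt p y (g ^ p • ω) (g • η) := by
  obtain ⟨f, rfl, rfl⟩ := h
  refine ⟨fun i => g * f i, ?_, ?_⟩
  · rw [smul_smul, Finset.mul_sum]
    simp only [mul_pow, mul_assoc]
  · rw [smul_smul]

theorem natCast_smul (n : ℕ) (h : IsCartierAt p y ω η) :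
    IsCartierAt p y ((n : F) • ω) ((n : F) • η) := by
  have := h.pow_smul (n : F)
  rwa [natCast_pow_char] at this

theorem zero {p : ℕ} [Fact p.Prime] (y : F) : IsCartierAt p y (0 : Ω[F⁄K]) 0 :=
  ⟨0, by simp [(Fact.out : p.Prime).ne_zero], by simp⟩

theorem sum {ι : Type*} (s : Finset ι) {f g : ι → Ω[F⁄K]}
    (h : ∀ i ∈ s, IsCartierAt p y (f i) (g i)) :
    IsCartierAt p y (∑ i ∈ s, f i) (∑ i ∈ s, g i) := by
  classical
  induction s using Finset.induction_on with
  | empty => simpa using zero y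
  | insert a s ha ih =>
    rw [Finset.sum_insert ha, Finset.sum_insert ha]
    exact (h a (Finset.mem_insert_self a s)).add
      (ih fun i hi => h i (Finset.mem_insert_of_mem hi))

theorem pow_smul_derivation_self {p : ℕ} [Fact p.Prime] {y : F} {j : ℕ} (hj : j < p) :
    IsCartierAt p y (y ^ j • KaehlerDifferential.D K F y)
      ((if p - 1 = j then (1 : F) else 0) • KaehlerDifferential.D K F y) := by
  refine ⟨fun i => if i = j then 1 else 0, ?_, rfl⟩
  congr 1
  rw [Finset.sum_eq_single j]
  · simp
  · intro i _ hi
    simp [hi, (Fact.out : p.Prime).ne_zero]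
  · intro h
    exact absurd (Finset.mem_range.2 hj) h

/-- By Leibniz, `(fg)^(p-1) d(fg) = f^p · g^(p-1) dg + g^p · f^(p-1) df`, and `𝒞` pulls out `p`-th
powers. -/
theorem pow_pred_smul_derivation_mul {f g : F}
    (hf : IsCartierAt p y (f ^ (p - 1) • KaehlerDifferential.D K F f) (KaehlerDifferential.D K F f))
    (hg : IsCartierAt p y (g ^ (p - 1) • KaehlerDifferential.D K F g)
      (KaehlerDifferential.D K F g)) :
    IsCartierAt p y ((f * g) ^ (p - 1) • KaehlerDifferential.D K F (f * g))
      (KaehlerDifferential.D K F (f * g)) := by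
  have h := (hg.pow_smul f).add (hf.pow_smul g)
  rw [← Derivation.leibniz] at h
  convert h using 1
  have hp : p = p - 1 + 1 := (Nat.sub_add_cancel (Fact.out : p.Prime).one_le).symm
  have e : ∀ z : F, z ^ p = z ^ (p - 1) * z := fun z => by
    conv_lhs => rw [hp, pow_succ]
  rw [Derivation.leibniz, smul_add, smul_smul, smul_smul, smul_smul, smul_smul, e, e]
  congr 2 <;> ring

theorem pow_pred_smul_derivation_pow_char (y f : F) :
    IsCartierAt p y ((f ^ p) ^ (p - 1) • KaehlerDifferential.D K F (f ^ p))
      (KaehlerDifferential.D K F (f ^ p)) := by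
  rw [derivation_pow_char, smul_zero]
  exact zero y

theorem pow_pred_smul_derivation_pow {f : F}
    (hf : IsCartierAt p y (f ^ (p - 1) • KaehlerDifferential.D K F f) (KaehlerDifferential.D K F f))
    (n : ℕ) :
    IsCartierAt p y ((f ^ n) ^ (p - 1) • KaehlerDifferential.D K F (f ^ n))
      (KaehlerDifferential.D K F (f ^ n)) := by
  induction n with
  | zero =>
    have := pow_pred_smul_derivation_pow_char (K := K) (p := p) y 1
    rwa [one_pow, ← pow_zero f] at this
  | succ n ih =>
    rw [pow_succ]
    exact pow_pred_smul_derivation_mul ih hf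

variable [Finite K] [IsCurveFunctionField K F]

theorem unique (hy : ∀ z : F, z ^ p ≠ y) (h : IsCartierAt p y ω η) (h' : IsCartierAt p y ω η') :
    η = η' := by
  obtain ⟨f, rfl, rfl⟩ := h
  obtain ⟨g, h1, rfl⟩ := h'
  rw [coeff_eq_of_sum_pow_mul_pow_eq hy (smul_derivation_inj hy h1)
    (Nat.sub_lt (Fact.out : p.Prime).pos one_pos)]

theorem exists_of_pow_ne (hy : ∀ z : F, z ^ p ≠ y) (ω : Ω[F⁄K]) : ∃ η, IsCartierAt p y ω η := by
  obtain ⟨f, rfl⟩ := exists_eq_smul_derivation hy ω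
  obtain ⟨a, rfl⟩ := exists_eq_sum_pow_mul_pow K hy f
  exact ⟨_, a, rfl, rfl⟩

/-- The Cartier operator vanishes on exact differentials. -/
theorem derivation (hy : ∀ z : F, z ^ p ≠ y) (f : F) :
    IsCartierAt p y (KaehlerDifferential.D K F f) 0 := by
  obtain ⟨a, rfl⟩ := exists_eq_sum_pow_mul_pow K hy f
  rw [derivation_sum_pow_mul_pow, Finset.sum_smul]
  have h0 : (0 : Ω[F⁄K]) = ∑ i ∈ Finset.range p, (0 : Ω[F⁄K]) := by simp
  rw [h0]
  refine sum _ fun i hi => ?_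
  rw [mul_smul, mul_smul]
  rcases i with _ | j
  · simpa using zero y
  -- Differentiation lowers the exponent below `p - 1`, so no `y^(p-1)` term is left.
  · have hj : j + 1 < p := Finset.mem_range.1 hi
    have h := ((pow_smul_derivation_self (K := K) (y := y)
      (by omega : j < p)).natCast_smul (j + 1)).pow_smul (a (j + 1))
    rw [if_neg (by omega), zero_smul, smul_zero, smul_zero] at h
    exact h

/-- `(j + 1) f^j df` is exact, and `j + 1` is invertible and equal to its own `p`-th power. -/
theorem pow_smul_derivation (hy : ∀ z : F, z ^ p ≠ y) (f : F) {j : ℕ} (hj : j + 1 < p) :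
    IsCartierAt p y (f ^ j • KaehlerDifferential.D K F f) 0 := by
  have h := (derivation (K := K) hy (f ^ (j + 1))).pow_smul (((j + 1 : ℕ) : F)⁻¹)
  have hne : ((j + 1 : ℕ) : F) ≠ 0 := by
    rw [Ne, CharP.cast_eq_zero_iff F p]
    exact Nat.not_dvd_of_pos_of_lt j.succ_pos hj
  rw [inv_pow, natCast_pow_char, Derivation.leibniz_pow, ← Nat.cast_smul_eq_nsmul F,
    inv_smul_smul₀ hne, smul_zero] at h
  exact h

/-- Expand `(f + 1)^(p-1)`: `𝒞` kills every `f^i df` except the top one. -/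
theorem pow_pred_smul_derivation_add_one (hy : ∀ z : F, z ^ p ≠ y) {f : F}
    (hf : IsCartierAt p y (f ^ (p - 1) • KaehlerDifferential.D K F f)
      (KaehlerDifferential.D K F f)) :
    IsCartierAt p y ((f + 1) ^ (p - 1) • KaehlerDifferential.D K F (f + 1))
      (KaehlerDifferential.D K F (f + 1)) := by
  have hp : p = p - 1 + 1 := (Nat.sub_add_cancel (Fact.out : p.Prime).one_le).symm
  rw [map_add, Derivation.map_one_eq_zero, add_zero, add_pow, Finset.sum_range_succ, add_smul]
  simp only [one_pow, mul_one, Nat.choose_self, Nat.cast_one]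
  rw [Finset.sum_smul]
  have h : IsCartierAt p y (∑ i ∈ Finset.range (p - 1),
      (f ^ i * ((p - 1).choose i : F)) • KaehlerDifferential.D K F f)
      (∑ i ∈ Finset.range (p - 1), 0) := by
    refine sum _ fun i hi => ?_
    have hi := Finset.mem_range.1 hi
    rw [mul_comm, mul_smul]
    have := (pow_smul_derivation (K := K) hy f (by omega : i + 1 < p)).natCast_smul
      ((p - 1).choose i)
    rwa [smul_zero] at this
  have := h.add hf
  rwa [Finset.sum_const_zero, zero_add] at this

theorem pow_pred_smul_derivation_add (hy : ∀ z : F, z ^ p ≠ y) {f g : F}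
    (hf : IsCartierAt p y (f ^ (p - 1) • KaehlerDifferential.D K F f) (KaehlerDifferential.D K F f))
    (hg : IsCartierAt p y (g ^ (p - 1) • KaehlerDifferential.D K F g)
      (KaehlerDifferential.D K F g)) :
    IsCartierAt p y ((f + g) ^ (p - 1) • KaehlerDifferential.D K F (f + g))
      (KaehlerDifferential.D K F (f + g)) := by
  by_cases hg0 : g = 0
  · simpa [hg0] using hf
  have hp : p = p - 1 + 1 := (Nat.sub_add_cancel (Fact.out : p.Prime).one_le).symm
  -- This writes the inverse as a `p`-th power times a power of `g`, so that multiplicativity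
  -- reaches `g⁻¹`; then `f + g = (f/g + 1) g` reduces sums to adding `1`.
  have e : g⁻¹ = (g⁻¹) ^ p * g ^ (p - 1) := by
    conv_rhs => rw [hp, pow_succ, Nat.add_sub_cancel]
    rw [mul_right_comm, inv_pow, inv_mul_cancel₀ (pow_ne_zero _ hg0), one_mul]
  have hinv : IsCartierAt p y (g⁻¹ ^ (p - 1) • KaehlerDifferential.D K F g⁻¹)
      (KaehlerDifferential.D K F g⁻¹) := by
    rw [e]
    exact pow_pred_smul_derivation_mul (pow_pred_smul_derivation_pow_char _ _)
      (pow_pred_smul_derivation_pow hg _)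
  have e' : f + g = (f * g⁻¹ + 1) * g := by field_simp
  rw [e']
  exact pow_pred_smul_derivation_mul
    (pow_pred_smul_derivation_add_one hy (pow_pred_smul_derivation_mul hf hinv)) hg

/-- `𝒞(f ^ (p - 1) df) = df`. -/
theorem pow_pred_smul_derivation (hy : ∀ z : F, z ^ p ≠ y) (f : F) :
    IsCartierAt p y (f ^ (p - 1) • KaehlerDifferential.D K F f)
      (KaehlerDifferential.D K F f) := by
  obtain ⟨a, rfl⟩ := exists_eq_sum_pow_mul_pow K hy f
  -- The property is stable under sums and products, and holds for `p`-th powers and for `y`, which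
  -- generate `F`.
  refine Finset.sum_induction _ (fun f => IsCartierAt p y
    (f ^ (p - 1) • KaehlerDifferential.D K F f) (KaehlerDifferential.D K F f))
    (fun f g hf hg => pow_pred_smul_derivation_add hy hf hg) (by simpa using zero y) fun i _ => ?_
  refine pow_pred_smul_derivation_mul (pow_pred_smul_derivation_pow_char _ _)
    (pow_pred_smul_derivation_pow ?_ _)
  have := pow_smul_derivation_self (K := K) (y := y) (p := p) (j := p - 1)
    (Nat.sub_lt (Fact.out : p.Prime).pos one_pos)
  rwa [if_pos rfl, one_smul] at this

/-- The Cartier operator does not depend on the element used to compute it. -/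
theorem change (hy : ∀ z : F, z ^ p ≠ y) {x : F} (h : IsCartierAt p x ω η) :
    IsCartierAt p y ω η := by
  obtain ⟨f, rfl, rfl⟩ := h
  have hp : p = p - 1 + 1 := (Nat.sub_add_cancel (Fact.out : p.Prime).one_le).symm
  have hr : Finset.range p = Finset.range (p - 1 + 1) := by rw [← hp]
  rw [hr, Finset.sum_range_succ, add_smul, Finset.sum_smul]
  have h : IsCartierAt p y (∑ i ∈ Finset.range (p - 1),
      (f i ^ p * x ^ i) • KaehlerDifferential.D K F x) (∑ i ∈ Finset.range (p - 1), 0) := by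
    refine sum _ fun i hi => ?_
    have hi := Finset.mem_range.1 hi
    rw [mul_smul]
    have := (pow_smul_derivation (K := K) hy x (by omega : i + 1 < p)).pow_smul (f i)
    rwa [smul_zero] at this
  have := h.add ((pow_pred_smul_derivation (K := K) hy x).pow_smul (f (p - 1)))
  rwa [Finset.sum_const_zero, zero_add, smul_smul] at this

theorem isCartier (h : IsCartierAt p y ω η) : IsCartier p ω η :=
  fun _ hx => h.change hx.pow_ne

end IsCartierAt

variable [Finite K] [IsCurveFunctionField K F]

/-- This is applied with `y` a uniformiser. A separating element must exist for the universal
quantifier in `IsCartier` to carry information. -/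
theorem IsCartier.isCartierAt (h : IsCartier p ω η) (hy : ∀ z : F, z ^ p ≠ y) :
    IsCartierAt p y ω η := by
  obtain ⟨x, hx⟩ := exists_isSeparating (K := K) (F := F)
  exact IsCartierAt.change hy (h x hx)

theorem IsCartier.unique (h : IsCartier p ω η) (h' : IsCartier p ω η') : η = η' := by
  obtain ⟨x, hx⟩ := exists_isSeparating (K := K) (F := F)
  exact IsCartierAt.unique hx.pow_ne (h x hx) (h' x hx)

theorem exists_isCartier (p : ℕ) [Fact p.Prime] [CharP F p] (ω : Ω[F⁄K]) :
    ∃ η, IsCartier p ω η := by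
  obtain ⟨x, hx⟩ := exists_isSeparating (K := K) (F := F)
  obtain ⟨η, hη⟩ := IsCartierAt.exists_of_pow_ne (p := p) hx.pow_ne ω
  exact ⟨η, hη.isCartier⟩

theorem IsCartierIter.unique : ∀ {s : ℕ} {ω η η' : Ω[F⁄K]}, IsCartierIter p s ω η →
    IsCartierIter p s ω η' → η = η'
  | 0, _, _, _, h, h' => Eq.trans (Eq.symm h) h'
  | s + 1, _, _, _, ⟨θ, h1, h2⟩, ⟨θ', h3, h4⟩ => by
    obtain rfl := h1.unique h3
    exact IsCartierIter.unique h2 h4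

theorem exists_isCartierIter (p : ℕ) [Fact p.Prime] [CharP F p] : ∀ (s : ℕ) (ω : Ω[F⁄K]),
    ∃ η, IsCartierIter p s ω η
  | 0, ω => ⟨ω, rfl⟩
  | s + 1, ω => by
    obtain ⟨θ, hθ⟩ := exists_isCartier p ω
    obtain ⟨η, hη⟩ := exists_isCartierIter p s θ
    exact ⟨η, θ, hθ, hη⟩

end Cartier

/-! ### Orders and residues at a place -/

namespace Place

variable {K F : Type*} [Field K] [Field F] [Algebra K F] {P : Place K F}

theorem exists_valuation_eq_exp (P : Place K F) {f : F} (hf : f ≠ 0) :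
    ∃ n : ℤ, P.valuation f = WithZero.exp n :=
  ⟨_, (WithZero.exp_log ((Valuation.ne_zero_iff _).2 hf)).symm⟩

theorem valuation_lt_one_iff_mem (P : Place K F) (f : P.localRing) :
    P.valuation f < 1 ↔ f ∈ IsLocalRing.maximalIdeal P.localRing :=
  (IsDiscreteValuationRing.maximalIdeal P.localRing).valuation_lt_one_iff_mem (K := F) f

theorem mem_localRing_iff {f : F} : f ∈ P.localRing ↔ P.valuation f ≤ 1 := by
  refine ⟨fun h => (IsDiscreteValuationRing.maximalIdeal P.localRing).valuation_le_one
    (⟨f, h⟩ : P.localRing), fun h => ?_⟩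
  by_contra hf
  have hf0 : f ≠ 0 := fun h0 => hf (h0 ▸ zero_mem _)
  have hinv := (P.localRing.mem_or_inv_mem f).resolve_left hf
  have hlt : P.valuation f⁻¹ < 1 := by
    refine (P.valuation_lt_one_iff_mem ⟨f⁻¹, hinv⟩).2 ?_
    rw [IsLocalRing.mem_maximalIdeal, mem_nonunits_iff]
    intro hu
    obtain ⟨⟨g, hg⟩, hg'⟩ := hu.exists_right_inv
    have : f⁻¹ * g = 1 := congrArg Subtype.val hg'
    have : g = f := by field_simp at this; exact this
    exact hf (this ▸ hg)
  have h1 : P.valuation f * P.valuation f⁻¹ = 1 := by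
    rw [← map_mul, mul_inv_cancel₀ hf0, map_one]
  have hlt' : P.valuation f * P.valuation f⁻¹ < 1 :=
    lt_of_le_of_lt (mul_le_mul' h le_rfl) (by rwa [one_mul])
  exact absurd h1 hlt'.ne

theorem ordGE_zero_iff {f : F} : P.OrdGE 0 f ↔ f ∈ P.localRing := by
  rw [mem_localRing_iff, OrdGE, neg_zero, WithZero.exp_zero]

theorem ordGE_zero_right (m : ℤ) : P.OrdGE m 0 := by simp [OrdGE]

theorem OrdGE.mono {m n : ℤ} {f : F} (h : P.OrdGE n f) (hmn : m ≤ n) : P.OrdGE m f :=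
  le_trans h (WithZero.exp_le_exp.2 (by omega))

theorem OrdGE.mul {m n : ℤ} {f g : F} (hf : P.OrdGE m f) (hg : P.OrdGE n g) :
    P.OrdGE (m + n) (f * g) := by
  unfold OrdGE at *
  rw [map_mul, neg_add, WithZero.exp_add]
  exact mul_le_mul' hf hg

theorem OrdGE.sub {m : ℤ} {f g : F} (hf : P.OrdGE m f) (hg : P.OrdGE m g) :
    P.OrdGE m (f - g) := Valuation.map_sub_le _ hf hg

theorem exists_isUniformizer (P : Place K F) : ∃ t : F, P.IsUniformizer t :=
  (IsDiscreteValuationRing.maximalIdeal P.localRing).valuation_exists_uniformizer F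

theorem valuation_algebraMap (P : Place K F) {a : K} (ha : a ≠ 0) :
    P.valuation (algebraMap K F a) = 1 := by
  refine le_antisymm (mem_localRing_iff.1 (P.algebraMap_mem a)) ?_
  have h := mem_localRing_iff.1 (P.algebraMap_mem a⁻¹)
  have h1 : P.valuation (algebraMap K F a) * P.valuation (algebraMap K F a⁻¹) = 1 := by
    rw [← map_mul, ← map_mul, mul_inv_cancel₀ ha, map_one, map_one]
  calc 1 = P.valuation (algebraMap K F a) * P.valuation (algebraMap K F a⁻¹) := h1.symm
    _ ≤ P.valuation (algebraMap K F a) * 1 := mul_le_mul' le_rfl h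
    _ = _ := mul_one _

namespace IsUniformizer

variable {t : F}

theorem ne_zero (ht : P.IsUniformizer t) : t ≠ 0 := by
  rintro rfl
  rw [IsUniformizer, map_zero] at ht
  exact WithZero.exp_ne_zero ht.symm

theorem mem_localRing (ht : P.IsUniformizer t) : t ∈ P.localRing := by
  rw [mem_localRing_iff, ht, ← WithZero.exp_zero, WithZero.exp_le_exp]
  omega

theorem valuation_pow (ht : P.IsUniformizer t) (n : ℕ) :
    P.valuation (t ^ n) = WithZero.exp (-n : ℤ) := by
  rw [map_pow, ht, ← WithZero.exp_nsmul]
  simp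

theorem valuation_zpow (ht : P.IsUniformizer t) (n : ℤ) :
    P.valuation (t ^ n) = WithZero.exp (-n) := by
  rw [map_zpow₀, ht, ← WithZero.exp_zsmul]
  simp

theorem valuation_pow_mul_pow (ht : P.IsUniformizer t) {f : F} {n : ℤ}
    (hf : P.valuation f = WithZero.exp n) (p i : ℕ) :
    P.valuation (f ^ p * t ^ i) = WithZero.exp (p * n - i) := by
  rw [map_mul, ht.valuation_pow, map_pow, hf, ← WithZero.exp_nsmul, ← WithZero.exp_add]
  simp [sub_eq_add_neg]

variable {p : ℕ} [Fact p.Prime]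

theorem pow_ne (ht : P.IsUniformizer t) (z : F) : z ^ p ≠ t := by
  rintro rfl
  have hz : z ≠ 0 := fun h => ht.ne_zero (by rw [h, zero_pow (Fact.out : p.Prime).ne_zero])
  obtain ⟨n, hn⟩ := P.exists_valuation_eq_exp hz
  rw [IsUniformizer, map_pow, hn, ← WithZero.exp_nsmul, WithZero.exp_inj, nsmul_eq_mul] at ht
  have : (p : ℤ) ∣ 1 := ⟨-n, by linarith⟩
  exact (Fact.out : p.Prime).one_lt.ne'
    (by exact_mod_cast Int.eq_one_of_dvd_one (by positivity) this)

/-- The terms of `∑ aᵢ ^ p t ^ i` have distinct valuations, so none is below that of the sum. -/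
theorem ordGE_of_ordGE_sum (ht : P.IsUniformizer t) {a : ℕ → F} {m : ℤ}
    (h : P.OrdGE m (∑ i ∈ Finset.range p, a i ^ p * t ^ i)) {i : ℕ} (hi : i < p) :
    P.OrdGE m (a i ^ p * t ^ i) := by
  have hp : p.Prime := Fact.out
  obtain ⟨j, hj, hmax⟩ := Finset.exists_max_image (Finset.range p)
    (fun i => P.valuation (a i ^ p * t ^ i)) ⟨0, Finset.mem_range.2 hp.pos⟩
  refine (hmax i (Finset.mem_range.2 hi)).trans ?_
  by_cases h0 : a j = 0
  · simp [h0, hp.ne_zero]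
  obtain ⟨n, hn⟩ := P.exists_valuation_eq_exp h0
  have hlt : ∀ l ∈ Finset.range p \ {j},
      P.valuation (a l ^ p * t ^ l) < P.valuation (a j ^ p * t ^ j) := by
    intro l hl
    rw [Finset.mem_sdiff, Finset.mem_singleton] at hl
    refine lt_of_le_of_ne (hmax l hl.1) fun heq => ?_
    by_cases h0' : a l = 0
    · rw [ht.valuation_pow_mul_pow hn, h0', zero_pow hp.ne_zero, zero_mul, map_zero] at heq
      exact WithZero.exp_ne_zero heq.symm
    · obtain ⟨n', hn'⟩ := P.exists_valuation_eq_exp h0'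
      rw [ht.valuation_pow_mul_pow hn, ht.valuation_pow_mul_pow hn', WithZero.exp_inj] at heq
      have hl1 := Finset.mem_range.1 hl.1
      have hj1 := Finset.mem_range.1 hj
      -- Equal orders force `l ≡ j` modulo `p`, while both indices are below `p`.
      have hd : (p : ℤ) ∣ (l : ℤ) - j := ⟨n' - n, by linarith⟩
      have hz := Int.eq_zero_of_abs_lt_dvd hd (by rw [abs_lt]; constructor <;> omega)
      exact hl.2 (by omega)
  rw [OrdGE, Valuation.map_sum_eq_of_lt _ hj hlt] at h
  exact h

/-- From `p (n - 1) + i < m ≤ p v(f) + i` follows `v(f) > n - 1`; integrality does the rounding. -/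
theorem ordGE_of_ordGE_pow_mul_pow (ht : P.IsUniformizer t) {f : F} {m n : ℤ} {i : ℕ}
    (h : P.OrdGE m (f ^ p * t ^ i)) (hmn : (p : ℤ) * (n - 1) + i < m) : P.OrdGE n f := by
  by_cases hf : f = 0
  · rw [hf]
    exact ordGE_zero_right n
  obtain ⟨l, hl⟩ := P.exists_valuation_eq_exp hf
  rw [OrdGE, ht.valuation_pow_mul_pow hl, WithZero.exp_le_exp] at h
  rw [OrdGE, hl, WithZero.exp_le_exp]
  have hp : (0 : ℤ) < p := by exact_mod_cast (Fact.out : p.Prime).pos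
  have : (p : ℤ) * (n - 1) < p * (-l) := by linarith
  have := lt_of_mul_lt_mul_left this hp.le
  omega

variable [CharP F p] [Finite K] [IsCurveFunctionField K F]

/-- For regular `f = ∑ aᵢ^p t^i` no cancellation occurs, so `p v(aᵢ) + i ≥ 0` with `i < p`, and
every `aᵢ` is regular. Differentiating termwise keeps regularity. -/
theorem exists_derivation_eq (p : ℕ) [Fact p.Prime] [CharP F p] (ht : P.IsUniformizer t) {f : F}
    (hf : f ∈ P.localRing) : ∃ u ∈ P.localRing,
      KaehlerDifferential.D K F f = u • KaehlerDifferential.D K F t := by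
  obtain ⟨a, rfl⟩ := exists_eq_sum_pow_mul_pow K (ht.pow_ne (p := p)) f
  refine ⟨_, ?_, derivation_sum_pow_mul_pow a t⟩
  refine sum_mem fun i hi => ?_
  have hi := Finset.mem_range.1 hi
  have h := ht.ordGE_of_ordGE_sum (ordGE_zero_iff.2 hf) hi
  have ha : a i ∈ P.localRing :=
    ordGE_zero_iff.1 (ht.ordGE_of_ordGE_pow_mul_pow h (by push_cast; omega))
  exact mul_mem (pow_mem ha p) (mul_mem (natCast_mem _ i) (pow_mem ht.mem_localRing _))

/-- A single uniformiser suffices to check `DiffOrdGE`, since `dt` is a regular multiple of any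
other `dt'`. -/
theorem diffOrdGE_smul (p : ℕ) [Fact p.Prime] [CharP F p] (ht : P.IsUniformizer t) {f : F} {m : ℤ}
    (hf : P.OrdGE m f) : P.DiffOrdGE m (f • KaehlerDifferential.D K F t) := by
  intro t' ht'
  obtain ⟨u, hu, h⟩ := ht'.exists_derivation_eq p ht.mem_localRing
  refine ⟨f * u, ?_, by rw [h, smul_smul]⟩
  have := hf.mul (ordGE_zero_iff.2 hu)
  rwa [add_zero] at this

end IsUniformizer

theorem DiffOrdGE.mono {m n : ℤ} {ω : Ω[F⁄K]} (h : P.DiffOrdGE n ω) (hmn : m ≤ n) :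
    P.DiffOrdGE m ω := by
  intro t ht
  obtain ⟨f, hf, rfl⟩ := h t ht
  exact ⟨f, hf.mono hmn, rfl⟩

theorem DiffOrdGE.sub {m : ℤ} {ω η : Ω[F⁄K]} (h : P.DiffOrdGE m ω) (h' : P.DiffOrdGE m η) :
    P.DiffOrdGE m (ω - η) := by
  intro t ht
  obtain ⟨f, hf, rfl⟩ := h t ht
  obtain ⟨g, hg, rfl⟩ := h' t ht
  exact ⟨f - g, hf.sub hg, by rw [sub_smul]⟩

/-- `ω` has a pole of order at most one at `P`, with residue `a`, in terms of the uniformiser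
`t`. -/
def HasSimpleResidue (P : Place K F) (t : F) (ω : Ω[F⁄K]) (a : K) : Prop :=
  ∃ r ∈ P.localRing, ω = (algebraMap K F a * t⁻¹ + r) • KaehlerDifferential.D K F t

/-- Polar terms of different orders cannot cancel, so a top coefficient beyond `c 0` must vanish;
induction removes them all. -/
theorem sum_range_eq_of_ordGE {t : F} (ht : P.IsUniformizer t) (c : ℕ → K) :
    ∀ N : ℕ, P.OrdGE (-1) (∑ i ∈ Finset.range (N + 1), algebraMap K F (c i) * (t ^ (i + 1))⁻¹) →
      ∑ i ∈ Finset.range (N + 1), algebraMap K F (c i) * (t ^ (i + 1))⁻¹ =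
        algebraMap K F (c 0) * t⁻¹
  | 0, _ => by simp
  | N + 1, h => by
    have hv : ∀ i, c i ≠ 0 →
        P.valuation (algebraMap K F (c i) * (t ^ (i + 1))⁻¹) = WithZero.exp (i + 1 : ℤ) := by
      intro i hi
      rw [map_mul, P.valuation_algebraMap hi, one_mul, ← zpow_natCast, ← zpow_neg,
        ht.valuation_zpow]
      simp
    by_cases h0 : c (N + 1) = 0
    · rw [Finset.sum_range_succ, h0, map_zero, zero_mul, add_zero] at h ⊢
      exact sum_range_eq_of_ordGE ht c N h
    · exfalso
      rw [OrdGE, Valuation.map_sum_eq_of_lt _ (Finset.self_mem_range_succ (N + 1)), hv _ h0,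
        WithZero.exp_le_exp] at h
      · push_cast at h
        omega
      · intro i hi
        rw [Finset.mem_sdiff, Finset.mem_singleton, Finset.mem_range] at hi
        rw [hv _ h0]
        by_cases hi0 : c i = 0
        · rw [hi0, map_zero, zero_mul, map_zero]
          exact WithZero.exp_pos
        · rw [hv _ hi0, WithZero.exp_lt_exp]
          omega

theorem ordGE_const_mul_inv {t : F} (ht : P.IsUniformizer t) (a : K) :
    P.OrdGE (-1) (algebraMap K F a * t⁻¹) := by
  refine OrdGE.const_mul a ?_
  rw [OrdGE, ← zpow_neg_one, ht.valuation_zpow]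

/-- The residue is the value of `f t` at `P`, which lies in `K` because `P` is rational. -/
theorem DiffOrdGE.exists_hasSimpleResidue {ω : Ω[F⁄K]} {t : F} (hω : P.DiffOrdGE (-1) ω)
    (hP : P.IsRational) (ht : P.IsUniformizer t) : ∃ a, P.HasSimpleResidue t ω a := by
  obtain ⟨f, hf, h⟩ := hω t ht
  have hft : f * t ∈ P.localRing := by
    have h1 : P.OrdGE 1 t := ht.le
    have := hf.mul h1
    exact ordGE_zero_iff.1 this
  obtain ⟨a, ha⟩ := hP _ hft
  refine ⟨a, (f * t - algebraMap K F a) * t⁻¹, ?_, ?_⟩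
  · have := ha.mul (ordGE_const_mul_inv ht 1)
    rw [map_one, one_mul] at this
    exact ordGE_zero_iff.1 this
  · rw [h]
    congr 1
    have := ht.ne_zero
    field_simp
    ring

/-! ### Effect of the Cartier operator on orders and residues -/

section Cartier

variable {p : ℕ} [Fact p.Prime] [CharP F p] [Finite K] [IsCurveFunctionField K F] {ω η : Ω[F⁄K]}

/-- If `v_P(ω) ≥ m ≥ p n` then `v_P(𝒞 ω) ≥ n`. -/
theorem DiffOrdGE.cartier {m n : ℤ} (h : P.DiffOrdGE m ω) (hC : IsCartier p ω η)
    (hmn : (p : ℤ) * n ≤ m) : P.DiffOrdGE n η := by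
  obtain ⟨t, ht⟩ := P.exists_isUniformizer
  obtain ⟨f, hf, hω⟩ := h t ht
  obtain ⟨a, h1, rfl⟩ := hC.isCartierAt (y := t) ht.pow_ne
  obtain rfl := smul_derivation_inj (p := p) ht.pow_ne (hω.symm.trans h1)
  have hp : 0 < p := (Fact.out : p.Prime).pos
  refine ht.diffOrdGE_smul p (ht.ordGE_of_ordGE_pow_mul_pow
    (ht.ordGE_of_ordGE_sum hf (Nat.sub_lt hp one_pos)) ?_)
  -- For the coefficient of `t^(p-1)` the required bound is `p (n - 1) + (p - 1) = p n - 1 < m`.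
  have : ((p - 1 : ℕ) : ℤ) = p - 1 := by omega
  rw [this]
  linarith

theorem DiffOrdGE.cartierIter : ∀ {s : ℕ} {ω η : Ω[F⁄K]} {n : ℤ},
    P.DiffOrdGE ((p : ℤ) ^ s * n) ω → IsCartierIter p s ω η → P.DiffOrdGE n η
  | 0, _, _, _, h, hC => by
    obtain rfl := hC
    simpa using h
  | s + 1, _, _, n, h, ⟨_, h1, h2⟩ =>
    (h.cartier (n := (p : ℤ) ^ s * n) h1 (by rw [pow_succ]; linarith)).cartierIter h2

theorem HasResidue.hasSimpleResidue (p : ℕ) [Fact p.Prime] [CharP F p] {t : F} {a : K}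
    (h : P.HasResidue ω a)
    (hω : P.DiffOrdGE (-1) ω) (ht : P.IsUniformizer t) : P.HasSimpleResidue t ω a := by
  obtain ⟨N, c, r, hr, h1, rfl⟩ := h t ht
  obtain ⟨f, hf, h2⟩ := hω t ht
  have hfe := smul_derivation_inj (p := p) ht.pow_ne (h2.symm.trans h1)
  have hr' : P.OrdGE (-1) r := (ordGE_zero_iff.2 hr).mono (by omega)
  have hs : P.OrdGE (-1)
      (∑ i ∈ Finset.range (N + 1), algebraMap K F (c i) * (t ^ (i + 1))⁻¹) := by
    have := hf.sub hr'
    rwa [hfe, add_sub_cancel_right] at this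
  rw [sum_range_eq_of_ordGE ht c N hs] at h1
  exact ⟨r, hr, h1⟩

theorem HasSimpleResidue.unique (p : ℕ) [Fact p.Prime] [CharP F p] {t : F} {a b : K}
    (ht : P.IsUniformizer t) (h : P.HasSimpleResidue t ω a) (h' : P.HasSimpleResidue t ω b) :
    a = b := by
  obtain ⟨r, hr, h1⟩ := h
  obtain ⟨r', hr', h2⟩ := h'
  have he := smul_derivation_inj (p := p) ht.pow_ne (h1.symm.trans h2)
  by_contra hab
  have hm : algebraMap K F (a - b) * t⁻¹ ∈ P.localRing := by
    have : algebraMap K F (a - b) * t⁻¹ = r' - r := by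
      rw [map_sub]
      linear_combination he
    rw [this]
    exact sub_mem hr' hr
  rw [mem_localRing_iff, map_mul, P.valuation_algebraMap (sub_ne_zero.2 hab), one_mul,
    ← zpow_neg_one, ht.valuation_zpow, ← WithZero.exp_zero, WithZero.exp_le_exp] at hm
  omega

/-- `res_P(𝒞 ω) ^ p = res_P(ω)` for a simple pole. -/
theorem HasSimpleResidue.cartier {t : F} {b : K} (ht : P.IsUniformizer t)
    (hω : P.DiffOrdGE (-1) ω) (hC : IsCartier p ω η) (h : P.HasSimpleResidue t η b) :
    P.HasSimpleResidue t ω (b ^ p) := by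
  obtain ⟨f, hf, h0⟩ := hω t ht
  obtain ⟨a, h1, h2⟩ := hC.isCartierAt (y := t) ht.pow_ne
  obtain ⟨r, hr, h3⟩ := h
  obtain rfl := smul_derivation_inj (p := p) ht.pow_ne (h0.symm.trans h1)
  have ha := smul_derivation_inj (p := p) ht.pow_ne (h2.symm.trans h3)
  have hp : p = p - 1 + 1 := (Nat.sub_add_cancel (Fact.out : p.Prime).one_le).symm
  have hrange : Finset.range p = Finset.range (p - 1 + 1) := by rw [← hp]
  -- Only `a (p - 1) = b/t + r` can have a pole: for `i ≤ p - 2`, `p v(aᵢ) + i ≥ -1` forces `v(aᵢ) ≥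
  -- 0`. The last term is `(b/t + r)^p t^(p-1) = b^p/t + r^p t^(p-1)`.
  refine ⟨(∑ i ∈ Finset.range (p - 1), a i ^ p * t ^ i) + r ^ p * t ^ (p - 1), ?_, ?_⟩
  · refine add_mem (sum_mem fun i hi => mul_mem (pow_mem ?_ _) (pow_mem ht.mem_localRing _))
      (mul_mem (pow_mem hr _) (pow_mem ht.mem_localRing _))
    have hi := Finset.mem_range.1 hi
    exact ordGE_zero_iff.1 (ht.ordGE_of_ordGE_pow_mul_pow
      (ht.ordGE_of_ordGE_sum hf (by omega : i < p)) (by push_cast; omega))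
  · rw [h1, hrange, Finset.sum_range_succ, ha, add_pow_char, mul_pow, map_pow]
    congr 1
    have ht0 := ht.ne_zero
    have e : (t⁻¹) ^ p * t ^ (p - 1) = t⁻¹ := by
      conv_lhs => rw [hp, pow_succ, Nat.add_sub_cancel]
      rw [mul_right_comm, inv_pow, inv_mul_cancel₀ (pow_ne_zero _ ht0), one_mul]
    linear_combination (algebraMap K F b) ^ p * e

theorem HasSimpleResidue.cartierIter {t : F} (ht : P.IsUniformizer t) :
    ∀ {s : ℕ} {ω η : Ω[F⁄K]} {b : K}, P.DiffOrdGE (-1) ω → IsCartierIter p s ω η →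
      P.HasSimpleResidue t η b → P.HasSimpleResidue t ω (b ^ p ^ s)
  | 0, _, _, b, _, hC, h => by
    obtain rfl := hC
    simpa using h
  | s + 1, _, _, b, hω, ⟨θ, h1, h2⟩, h => by
    have hp : (1 : ℤ) ≤ p := by exact_mod_cast (Fact.out : p.Prime).one_le
    have hθ : P.DiffOrdGE (-1) θ := hω.cartier h1 (by linarith)
    have := (h.cartierIter ht hθ h2).cartier ht hω h1
    rwa [← pow_mul, ← pow_succ] at this

theorem DiffOrdGE.cartierIter_neg_one : ∀ {s : ℕ} {ω η : Ω[F⁄K]},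
    P.DiffOrdGE (-1) ω → IsCartierIter p s ω η → P.DiffOrdGE (-1) η
  | 0, _, _, h, hC => by
    obtain rfl := hC
    exact h
  | s + 1, _, _, h, ⟨_, h1, h2⟩ => by
    have hp : (1 : ℤ) ≤ p := by exact_mod_cast (Fact.out : p.Prime).one_le
    exact (h.cartier h1 (by linarith)).cartierIter_neg_one h2

end Cartier

end Place

/-! ### Affine models, finiteness of poles, and constants -/

section AffineModel

variable {K F : Type*} [Field K] [Field F] [Algebra K F]

/-- `B` is the coordinate ring of a smooth affine curve with function field `F`. -/
structure IsAffineModel (B : Subalgebra K F) : Prop where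
  isDedekindDomain : IsDedekindDomain B
  isFractionRing : IsFractionRing B F
  finiteType : Algebra.FiniteType K B

open IntermediateField.algebraAdjoinAdjoin in
-- Take the integral closure of `K[x]` in `F`. Separability makes it finite over `K[x]`, and
-- valuation rings contain it because they are integrally closed.
theorem IsSeparating.exists_isAffineModel [IsCurveFunctionField K F] {x : F}
    (hx : IsSeparating K x) : ∃ B : Subalgebra K F, IsAffineModel B ∧
      ∀ V : ValuationSubring F, (∀ a : K, algebraMap K F a ∈ V) → x ∈ V → ∀ b ∈ B, b ∈ V := by
  let A := Algebra.adjoin K {x}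
  have := hx.2
  have := hx.finiteDimensional
  have hPID : IsPrincipalIdealRing A := by
    let φ : Polynomial K →ₐ[K] A := Polynomial.aeval ⟨x, Algebra.self_mem_adjoin_singleton K x⟩
    refine IsPrincipalIdealRing.of_surjective φ ?_
    rintro ⟨z, hz⟩
    obtain ⟨q, rfl⟩ := (Algebra.adjoin_singleton_eq_range_aeval K x).le hz
    refine ⟨q, Subtype.ext ?_⟩
    exact (Polynomial.aeval_algHom_apply A.val _ q).symm
  have hD : IsDedekindDomain (integralClosure A F) := integralClosure.isDedekindDomain A K⟮x⟯ F
  have hFr : IsFractionRing (integralClosure A F) F :=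
    integralClosure.isFractionRing_of_finite_extension K⟮x⟯ F
  have hfin : Module.Finite A (integralClosure A F) :=
    IsIntegralClosure.finite A K⟮x⟯ F (integralClosure A F)
  have hA : Algebra.FiniteType K A := by
    rw [← Subalgebra.fg_iff_finiteType]
    exact ⟨{x}, by simp [A]⟩
  have hft : Algebra.FiniteType K (integralClosure A F) := Algebra.FiniteType.trans hA inferInstance
  refine ⟨(integralClosure A F).restrictScalars K, ⟨hD, hFr, hft⟩, fun V hK hxV b hb => ?_⟩
  have hAV : ∀ a ∈ A, a ∈ V := by
    intro a ha
    induction ha using Algebra.adjoin_induction with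
    | mem y hy =>
      rw [Set.mem_singleton_iff] at hy
      exact hy ▸ hxV
    | algebraMap r => exact hK r
    | add y z _ _ h1 h2 => exact add_mem h1 h2
    | mul y z _ _ h1 h2 => exact mul_mem h1 h2
  have hb' : IsIntegral A b := hb
  let i : A →+* V := (algebraMap A F).codRestrict V (fun a => hAV a a.2)
  let _ : Algebra A V := i.toAlgebra
  have : IsScalarTower A V F := IsScalarTower.of_algebraMap_eq fun _ => rfl
  obtain ⟨c, rfl⟩ := IsIntegrallyClosed.isIntegral_iff.1 (hb'.tower_top (A := V))
  exact c.2

theorem IsSeparating.inv {x : F} (hx : IsSeparating K x) : IsSeparating K x⁻¹ := by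
  have h : K⟮x⁻¹⟯ = K⟮x⟯ := by
    refine le_antisymm ?_ ?_
    · rw [IntermediateField.adjoin_simple_le_iff]
      exact inv_mem (IntermediateField.mem_adjoin_simple_self K x)
    · rw [IntermediateField.adjoin_simple_le_iff]
      have := inv_mem (IntermediateField.mem_adjoin_simple_self K x⁻¹)
      rwa [inv_inv] at this
  refine ⟨fun h' => hx.1 ?_, ?_⟩
  · have := h'.inv
    rwa [inv_inv] at this
  · rw [h]
    exact hx.2

/-- The curve is covered by two affine models. -/
theorem exists_isAffineModel_cover (K F : Type*) [Field K] [Field F] [Algebra K F] [Finite K]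
    [IsCurveFunctionField K F] :
    ∃ B B' : Subalgebra K F, IsAffineModel B ∧ IsAffineModel B' ∧
      ∀ V : ValuationSubring F, (∀ a : K, algebraMap K F a ∈ V) →
        (∀ b ∈ B, b ∈ V) ∨ (∀ b ∈ B', b ∈ V) := by
  obtain ⟨x, hx⟩ := exists_isSeparating (K := K) (F := F)
  obtain ⟨B, hB, h1⟩ := hx.exists_isAffineModel
  obtain ⟨B', hB', h2⟩ := hx.inv.exists_isAffineModel
  refine ⟨B, B', hB, hB', fun V hV => ?_⟩
  exact (V.mem_or_inv_mem x).imp (h1 V hV) (h2 V hV)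

variable {B : Subalgebra K F} {V : ValuationSubring F}

/-- The centre on `Spec B` of a valuation ring that contains `B`. -/
def centerIdeal (hV : ∀ b ∈ B, b ∈ V) : Ideal B :=
  (IsLocalRing.maximalIdeal V).comap ((algebraMap B F).codRestrict V (fun b => hV b b.2))

theorem mem_centerIdeal {hV : ∀ b ∈ B, b ∈ V} {b : B} :
    b ∈ centerIdeal hV ↔ V.valuation (b : F) < 1 := by
  rw [centerIdeal, Ideal.mem_comap, ValuationSubring.valuation_lt_one_iff]
  rfl

instance (hV : ∀ b ∈ B, b ∈ V) : (centerIdeal hV).IsPrime :=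
  Ideal.IsPrime.comap _

theorem inv_mem_of_notMem_centerIdeal {hV : ∀ b ∈ B, b ∈ V} {s : B} (hs : s ∉ centerIdeal hV) :
    (s : F)⁻¹ ∈ V := by
  rw [mem_centerIdeal, not_lt] at hs
  rw [← ValuationSubring.valuation_le_one_iff, map_inv₀]
  exact inv_le_one_of_one_le₀ hs

theorem coe_ne_zero_of_notMem_centerIdeal {hV : ∀ b ∈ B, b ∈ V} {s : B}
    (hs : s ∉ centerIdeal hV) : (s : F) ≠ 0 := by
  rintro h
  exact hs (by rw [mem_centerIdeal, h, map_zero]; exact zero_lt_one)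

theorem IsAffineModel.centerIdeal_ne_bot (hB : IsAffineModel B) (hV : ∀ b ∈ B, b ∈ V)
    (htop : V ≠ ⊤) : centerIdeal hV ≠ ⊥ := by
  intro hbot
  refine htop (eq_top_iff.2 fun z _ => ?_)
  have := hB.isFractionRing
  obtain ⟨b, s, hs, rfl⟩ := IsFractionRing.div_surjective B z
  have hs' : s ∉ centerIdeal hV := by
    rw [hbot, Ideal.mem_bot]
    exact nonZeroDivisors.ne_zero hs
  rw [div_eq_mul_inv]
  exact mul_mem (hV _ b.2) (inv_mem_of_notMem_centerIdeal hs')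

/-- A nontrivial valuation ring that contains `B` is the local ring at its centre. -/
theorem IsAffineModel.exists_mul_eq (hB : IsAffineModel B) (hV : ∀ b ∈ B, b ∈ V)
    (htop : V ≠ ⊤) {z : F} (hz : z ∈ V) :
    ∃ b s : B, s ∉ centerIdeal hV ∧ z * s = b := by
  have := hB.isDedekindDomain
  have := hB.isFractionRing
  set 𝔭 := centerIdeal hV
  by_cases hz0 : z = 0
  · exact ⟨0, 1, fun h => (Ideal.ne_top_iff_one _).1 (Ideal.IsPrime.ne_top inferInstance) h,
      by simp [hz0]⟩
  let S := Localization.AtPrime 𝔭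
  have hdvr : IsDiscreteValuationRing S :=
    IsLocalization.AtPrime.isDiscreteValuationRing_of_dedekind_domain B
      (hB.centerIdeal_ne_bot hV htop) S
  let _ : Algebra S F := (IsLocalization.lift (M := 𝔭.primeCompl) (S := S)
    (g := algebraMap B F) (fun s => by
      rw [isUnit_iff_ne_zero]
      exact coe_ne_zero_of_notMem_centerIdeal (hV := hV) s.2)).toAlgebra
  have : IsScalarTower B S F := IsScalarTower.of_algebraMap_eq fun b =>
    (IsLocalization.lift_eq _ b).symm
  have : IsFractionRing S F :=
    IsFractionRing.isFractionRing_of_isDomain_of_isLocalization 𝔭.primeCompl S F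
  have key : ∀ w : F, IsLocalization.IsInteger S w → ∃ b s : B, s ∉ 𝔭 ∧ w * s = b := by
    rintro _ ⟨y, rfl⟩
    obtain ⟨⟨b, s⟩, h⟩ := IsLocalization.surj 𝔭.primeCompl y
    refine ⟨b, s, s.2, ?_⟩
    have := congrArg (algebraMap S F) h
    rw [map_mul, ← IsScalarTower.algebraMap_apply, ← IsScalarTower.algebraMap_apply] at this
    exact this
  -- The localisation at the centre is a valuation ring, so it contains `z` or `z⁻¹`. If `z⁻¹ =
  -- b/s`, then `s = z b` with `z ∈ V`, so `b` in the centre would put `s` there too.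
  rcases ValuationRing.isInteger_or_isInteger S z with h | h
  · exact key z h
  · obtain ⟨b, s, hs, hbs⟩ := key _ h
    have hsb : (s : F) = z * b := by
      rw [← hbs]
      field_simp
    refine ⟨s, b, fun hb => hs ?_, hsb.symm⟩
    rw [mem_centerIdeal] at hb ⊢
    rw [hsb, map_mul]
    exact mul_lt_one_of_nonneg_of_lt_one_right ((V.valuation_le_one_iff z).2 hz) zero_le hb

/-- `V` is the localisation of a Dedekind domain at a nonzero prime. Thus every nontrivial valuation
ring over `K` is a place. -/
theorem IsAffineModel.isDiscreteValuationRing (hB : IsAffineModel B) (hV : ∀ b ∈ B, b ∈ V)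
    (htop : V ≠ ⊤) : IsDiscreteValuationRing V := by
  have := hB.isDedekindDomain
  let _ : Algebra B V := ((algebraMap B F).codRestrict V (fun b => hV b b.2)).toAlgebra
  have : IsLocalization.AtPrime V (centerIdeal hV) := by
    refine ⟨fun s => ?_, fun z => ?_, fun {a b} h => ⟨1, ?_⟩⟩
    · have h0 := coe_ne_zero_of_notMem_centerIdeal (hV := hV) s.2
      exact IsUnit.of_mul_eq_one (⟨(s : F)⁻¹, inv_mem_of_notMem_centerIdeal (hV := hV) s.2⟩ : V)
        (Subtype.ext (mul_inv_cancel₀ h0))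
    · obtain ⟨b, s, hs, h⟩ := hB.exists_mul_eq hV htop z.2
      exact ⟨(b, ⟨s, hs⟩), Subtype.ext h⟩
    · have : (a : F) = b := congrArg (Subtype.val : V → F) h
      rw [Subtype.ext this]
  exact IsLocalization.AtPrime.isDiscreteValuationRing_of_dedekind_domain B
    (hB.centerIdeal_ne_bot hV htop) V

theorem Place.localRing_ne_top (P : Place K F) : P.localRing ≠ ⊤ := by
  intro h
  obtain ⟨t, ht⟩ := P.exists_isUniformizer
  have h1 : t⁻¹ ∈ P.localRing := h ▸ ValuationSubring.mem_top _
  rw [mem_localRing_iff, ← zpow_neg_one, ht.valuation_zpow, ← WithZero.exp_zero,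
    WithZero.exp_le_exp] at h1
  omega

theorem Place.valuation_lt_one_iff (P : Place K F) {f : F} :
    P.localRing.valuation f < 1 ↔ P.valuation f < 1 := by
  by_cases hf : f ∈ P.localRing
  · rw [P.valuation_lt_one_iff_mem ⟨f, hf⟩, ValuationSubring.valuation_lt_one_iff]
  · refine iff_of_false (fun h => hf ?_) (fun h => hf (mem_localRing_iff.2 h.le))
    exact (P.localRing.valuation_le_one_iff f).1 h.le

theorem Place.ordGE_one_iff (P : Place K F) {f : F} : P.OrdGE 1 f ↔ P.valuation f < 1 := by
  by_cases hf : f = 0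
  · simp [hf, OrdGE]
  · obtain ⟨n, hn⟩ := P.exists_valuation_eq_exp hf
    rw [OrdGE, hn, ← WithZero.exp_zero, WithZero.exp_le_exp, WithZero.exp_lt_exp]
    omega

theorem IsAffineModel.place_eq (hB : IsAffineModel B) {P Q : Place K F}
    (hP : ∀ b ∈ B, b ∈ P.localRing) (hQ : ∀ b ∈ B, b ∈ Q.localRing)
    (h : centerIdeal hP = centerIdeal hQ) : P = Q := by
  have aux : ∀ {P Q : Place K F} (hP : ∀ b ∈ B, b ∈ P.localRing)
      (hQ : ∀ b ∈ B, b ∈ Q.localRing), centerIdeal hP = centerIdeal hQ →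
      P.localRing ≤ Q.localRing := by
    intro P Q hP hQ h z hz
    obtain ⟨b, s, hs, hbs⟩ := hB.exists_mul_eq hP P.localRing_ne_top hz
    rw [eq_div_of_mul_eq (coe_ne_zero_of_notMem_centerIdeal hs) hbs, div_eq_mul_inv]
    rw [h] at hs
    exact mul_mem (hQ _ b.2) (inv_mem_of_notMem_centerIdeal hs)
  have := le_antisymm (aux hP hQ h) (aux hQ hP h.symm)
  cases P
  cases Q
  congr

/-- A place is determined by its centre, and a nonzero `s` lies in only finitely many primes of a
Dedekind domain. -/
theorem IsAffineModel.finite_zeros (hB : IsAffineModel B) {s : B} (hs : s ≠ 0) :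
    {P : Place K F | ∃ hP : ∀ b ∈ B, b ∈ P.localRing, s ∈ centerIdeal hP}.Finite := by
  classical
  have := hB.isDedekindDomain
  let g : Place K F → Ideal B := fun P =>
    if h : ∀ b ∈ B, b ∈ P.localRing then centerIdeal h else ⊥
  refine Set.Finite.of_finite_image (f := g) ?_ ?_
  · have hI : Ideal.span {s} ≠ 0 := by
      rwa [Ne, Ideal.zero_eq_bot, Ideal.span_singleton_eq_bot]
    refine ((Ideal.finite_factors hI).image fun v => v.asIdeal).subset ?_
    rintro _ ⟨P, ⟨hP, hsP⟩, rfl⟩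
    refine ⟨⟨centerIdeal hP, inferInstance, hB.centerIdeal_ne_bot hP P.localRing_ne_top⟩, ?_, ?_⟩
    · rw [Set.mem_ofPred_eq, Ideal.dvd_span_singleton]
      exact hsP
    · simp only [g]
      rw [dif_pos hP]
  · rintro P ⟨hP, -⟩ Q ⟨hQ, -⟩ h
    simp only [g] at h
    rw [dif_pos hP, dif_pos hQ] at h
    exact hB.place_eq hP hQ h

theorem IsAffineModel.finite_poles (hB : IsAffineModel B) (f : F) :
    {P : Place K F | (∀ b ∈ B, b ∈ P.localRing) ∧ f ∉ P.localRing}.Finite := by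
  have := hB.isFractionRing
  obtain ⟨b, s, hs, rfl⟩ := IsFractionRing.div_surjective B f
  refine (hB.finite_zeros (nonZeroDivisors.ne_zero hs)).subset ?_
  rintro P ⟨hP, hf⟩
  refine ⟨hP, by_contra fun h => hf ?_⟩
  rw [div_eq_mul_inv]
  exact mul_mem (hP _ b.2) (inv_mem_of_notMem_centerIdeal h)

/-- The residue field of a place is finite over `K`. -/
theorem IsAffineModel.exists_finite_residue (hB : IsAffineModel B) (P : Place K F)
    (hP : ∀ b ∈ B, b ∈ P.localRing) :
    ∃ N : Submodule K F, N.FG ∧ ∀ f ∈ P.localRing, ∃ g ∈ N, P.OrdGE 1 (f - g) := by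
  have := hB.isDedekindDomain
  have := hB.finiteType
  set 𝔭 := centerIdeal hP
  have hmax : 𝔭.IsMaximal := Ideal.IsPrime.isMaximal inferInstance
    (hB.centerIdeal_ne_bot hP P.localRing_ne_top)
  have hfin : Module.Finite K (B ⧸ 𝔭) := by
    let _ : Field (B ⧸ 𝔭) := Ideal.Quotient.field 𝔭
    exact finite_of_finite_type_of_isJacobsonRing K (B ⧸ 𝔭)
  have : Module.Free K (B ⧸ 𝔭) := Module.Free.of_divisionRing K (B ⧸ 𝔭)
  -- A `K`-linear section of `B → B/𝔭` lifts the residue field, finite over `K` by Zariski's lemma,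
  -- to the required subspace of `F`.
  obtain ⟨σ, hσ⟩ := (Ideal.Quotient.mkₐ K 𝔭).toLinearMap.exists_rightInverse_of_surjective
    (LinearMap.range_eq_top.2 (Ideal.Quotient.mkₐ_surjective K 𝔭))
  refine ⟨LinearMap.range (B.val.toLinearMap ∘ₗ σ), ?_, fun f hf => ?_⟩
  · rw [← Submodule.map_top]
    exact hfin.1.map _
  obtain ⟨b, s, hs, hbs⟩ := hB.exists_mul_eq hP P.localRing_ne_top hf
  obtain ⟨s', hs'⟩ := hmax.exists_inv hs
  obtain ⟨π, hπ, hsum⟩ := hs'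
  set g := σ (Ideal.Quotient.mkₐ K 𝔭 (b * s')) with hg
  have hg' : b * s' - g ∈ 𝔭 :=
    Ideal.Quotient.eq.1 (LinearMap.congr_fun hσ (Ideal.Quotient.mkₐ K 𝔭 (b * s'))).symm
  refine ⟨g, ⟨_, rfl⟩, ?_⟩
  have hv : ∀ c ∈ 𝔭, P.OrdGE 1 (c : F) := fun c hc => by
    rw [P.ordGE_one_iff, ← P.valuation_lt_one_iff]
    exact mem_centerIdeal.1 hc
  -- With `s'` inverse to `s` modulo `𝔭`, `f = b/s` has the same residue as `b s'`, hence as its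
  -- lift `g`.
  have e : f - g = ((b * s' - g : B) : F) + f * π := by
    have : ((s' * s + π : B) : F) = 1 := by rw [hsum]; rfl
    push_cast at this ⊢
    linear_combination (-f) * this + s' * hbs
  rw [e]
  refine (hv _ hg').add ?_
  have := (Place.ordGE_zero_iff.2 hf).mul (hv _ hπ)
  rwa [zero_add] at this

theorem Place.exists_finite_residue [Finite K] [IsCurveFunctionField K F] (P : Place K F) :
    ∃ N : Submodule K F, N.FG ∧ ∀ f ∈ P.localRing, ∃ g ∈ N, P.OrdGE 1 (f - g) := by
  obtain ⟨B, B', hB, hB', h⟩ := exists_isAffineModel_cover K F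
  rcases h P.localRing P.algebraMap_mem with h | h
  · exact hB.exists_finite_residue P h
  · exact hB'.exists_finite_residue P h

theorem finite_setOf_notMem_localRing [Finite K] [IsCurveFunctionField K F] (f : F) :
    {P : Place K F | f ∉ P.localRing}.Finite := by
  obtain ⟨B, B', hB, hB', h⟩ := exists_isAffineModel_cover K F
  refine ((hB.finite_poles f).union (hB'.finite_poles f)).subset fun P hP => ?_
  exact (h P.localRing P.algebraMap_mem).imp (fun h => ⟨h, hP⟩) (fun h => ⟨h, hP⟩)

/-- A function without poles is constant. -/
theorem exists_algebraMap_eq_of_forall_mem [Finite K] [IsCurveFunctionField K F] {f : F}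
    (hf : ∀ P : Place K F, f ∈ P.localRing) : ∃ a : K, algebraMap K F a = f := by
  let R := (algebraMap K F).range
  have h : f ∈ (integralClosure (Subring.closure (R : Set F)) F).toSubring := by
    -- The integral closure of `K` is the intersection of the valuation rings above it, and the
    -- nontrivial ones are places.
    rw [← iInf_valuationSubring_superset, Subring.mem_iInf]
    rintro ⟨V, hV⟩
    have hK : ∀ a : K, algebraMap K F a ∈ V := fun a => hV ⟨a, rfl⟩
    by_contra hfV
    have htop : V ≠ ⊤ := fun h => hfV (h ▸ ValuationSubring.mem_top f)
    obtain ⟨B, B', hB, hB', hc⟩ := exists_isAffineModel_cover K F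
    have hdvr : IsDiscreteValuationRing V := (hc V hK).elim
      (fun h => hB.isDiscreteValuationRing h htop) (fun h => hB'.isDiscreteValuationRing h htop)
    exact hfV (hf ⟨V, hK, hdvr⟩)
  rw [Subring.closure_eq] at h
  have h' : IsIntegral R f := h
  let _ : Algebra K R := (algebraMap K F).rangeRestrict.toAlgebra
  have : IsScalarTower K R F := IsScalarTower.of_algebraMap_eq fun _ => rfl
  have : Algebra.IsIntegral K R :=
    Algebra.isIntegral_of_surjective (algebraMap K F).rangeRestrict_surjective
  exact IsCurveFunctionField.algebraic_mem f (isIntegral_trans f h').isAlgebraic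

end AffineModel

/-! ### Finite dimension of `Ω(A)` -/

section FiniteDimensional

variable {K F : Type*} [Field K] [Field F] [Algebra K F]

/-- The functions `f` with `v_P(f) ≥ m`. -/
def Place.ordSubmodule (P : Place K F) (m : ℤ) : Submodule K F where
  carrier := {f | P.OrdGE m f}
  add_mem' := fun hf hg => hf.add hg
  zero_mem' := Place.ordGE_zero_right m
  smul_mem' := fun a f hf => by
    rw [Algebra.smul_def]
    exact hf.const_mul a

variable {p : ℕ} [Fact p.Prime] [CharP F p] [Finite K] [IsCurveFunctionField K F]

/-- The coordinate of a differential with respect to `dy`. -/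
noncomputable def coord {y : F} (hy : ∀ z : F, z ^ p ≠ y) : Ω[F⁄K] →ₗ[F] F :=
  ((LinearEquiv.ofBijective (LinearMap.toSpanSingleton F Ω[F⁄K] (KaehlerDifferential.D K F y))
    ⟨fun _ _ h => smul_derivation_inj hy h, fun ω =>
      (exists_eq_smul_derivation hy ω).imp fun _ h => h.symm⟩).symm : Ω[F⁄K] ≃ₗ[F] F)

theorem coord_smul {y : F} (hy : ∀ z : F, z ^ p ≠ y) (f : F) :
    coord hy (f • KaehlerDifferential.D K F y) = f :=
  LinearEquiv.symm_apply_apply (LinearEquiv.ofBijective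
    (LinearMap.toSpanSingleton F Ω[F⁄K] (KaehlerDifferential.D K F y)) _) f

theorem coord_smul_derivation {y : F} (hy : ∀ z : F, z ^ p ≠ y) (ω : Ω[F⁄K]) :
    coord hy ω • KaehlerDifferential.D K F y = ω := by
  obtain ⟨f, rfl⟩ := exists_eq_smul_derivation hy ω
  rw [coord_smul]

/-- `Ω(A)/Ω(A + P)` embeds, by the leading coefficient in `t`, into `t^(A P)` times the residue
field, which is finite over `K`. -/
theorem fg_diffSpace_of_add_single (p : ℕ) [Fact p.Prime] [CharP F p] (A : Divisor K F)
    (P : Place K F) (h : (diffSpace (A + Finsupp.single P 1)).FG) : (diffSpace A).FG := by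
  classical
  obtain ⟨t, ht⟩ := P.exists_isUniformizer
  have hy : ∀ z : F, z ^ p ≠ t := ht.pow_ne
  obtain ⟨N, hN, hN'⟩ := P.exists_finite_residue
  let T : Ω[F⁄K] →ₗ[K] F ⧸ P.ordSubmodule (A P + 1) :=
    (P.ordSubmodule (A P + 1)).mkQ ∘ₗ (coord (K := K) hy).restrictScalars K
  let N' : Submodule K (F ⧸ P.ordSubmodule (A P + 1)) :=
    N.map ((P.ordSubmodule (A P + 1)).mkQ ∘ₗ LinearMap.mulLeft K (t ^ (A P)))
  have hfg : N'.FG := hN.map _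
  refine Submodule.fg_of_fg_map_of_fg_inf_ker T ?_ ?_
  · refine Submodule.FG.of_le hfg ?_
    rintro _ ⟨ω, hω, rfl⟩
    obtain ⟨f, hf, rfl⟩ := hω P t ht
    have ht0 := ht.ne_zero
    have hft : f * t ^ (-A P) ∈ P.localRing := by
      rw [← Place.ordGE_zero_iff, ← add_neg_cancel (A P)]
      exact hf.mul (ht.valuation_zpow _).le
    obtain ⟨g, hg, hgf⟩ := hN' _ hft
    refine ⟨g, hg, ?_⟩
    have : T (f • KaehlerDifferential.D K F t) = (P.ordSubmodule (A P + 1)).mkQ f := by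
      simp only [T, LinearMap.comp_apply, LinearMap.restrictScalars_apply, coord_smul]
    rw [this]
    simp only [LinearMap.comp_apply, LinearMap.mulLeft_apply]
    rw [eq_comm, ← sub_eq_zero, ← map_sub, Submodule.mkQ_apply, Submodule.Quotient.mk_eq_zero]
    have e : f - t ^ (A P) * g = t ^ (A P) * (f * t ^ (-A P) - g) := by
      rw [mul_sub, mul_left_comm, ← zpow_add₀ ht0, add_neg_cancel, zpow_zero, mul_one]
    rw [e]
    exact Place.OrdGE.mul (ht.valuation_zpow _).le hgf
  · refine Submodule.FG.of_le h ?_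
    rintro ω ⟨hω, hker⟩ Q
    by_cases hQ : Q = P
    · subst hQ
      rw [Finsupp.add_apply, Finsupp.single_eq_same, ← coord_smul_derivation hy ω]
      refine ht.diffOrdGE_smul p ?_
      have hker' : (Q.ordSubmodule (A Q + 1)).mkQ (coord hy ω) = 0 := hker
      rwa [Submodule.mkQ_apply, Submodule.Quotient.mk_eq_zero] at hker'
    · rw [Finsupp.add_apply, Finsupp.single_eq_of_ne hQ, add_zero]
      exact hω Q

theorem fg_diffSpace_of_add (p : ℕ) [Fact p.Prime] [CharP F p] (E : Place K F →₀ ℕ) :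
    ∀ A : Divisor K F, (diffSpace (A + E.mapRange (Nat.cast : ℕ → ℤ) rfl)).FG →
      (diffSpace A).FG := by
  induction E using Finsupp.induction_linear with
  | zero => exact fun A h => by simpa using h
  | add E E' h h' =>
    intro A hA
    rw [Finsupp.mapRange_add (by simp), ← add_assoc] at hA
    exact h A (h' _ hA)
  | single P n =>
    induction n with
    | zero => exact fun A h => by simpa using h
    | succ n ih =>
      intro A hA
      refine ih A (fg_diffSpace_of_add_single p _ P ?_)
      rw [Finsupp.mapRange_single] at hA ⊢
      rwa [Nat.cast_add, Nat.cast_one, Finsupp.single_add, ← add_assoc] at hA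

theorem coord_derivation_mul {y : F} (hy : ∀ z : F, z ^ p ≠ y) (f g : F) :
    coord hy (KaehlerDifferential.D K F (f * g)) =
      f * coord hy (KaehlerDifferential.D K F g) + g * coord hy (KaehlerDifferential.D K F f) := by
  rw [Derivation.leibniz, map_add, map_smul, map_smul, smul_eq_mul, smul_eq_mul]

/-- If `db/dy` is regular at `P` for finitely many generators `b` of `B`, then Leibniz and the
quotient rule make `f ↦ df/dy` preserve the local ring. So the bad places are poles of finitely many
functions. -/
theorem IsAffineModel.finite_setOf_coord_notMem {B : Subalgebra K F} (hB : IsAffineModel B)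
    {y : F} (hy : ∀ z : F, z ^ p ≠ y) :
    {P : Place K F | (∀ b ∈ B, b ∈ P.localRing) ∧ ∃ f ∈ P.localRing,
      coord hy (KaehlerDifferential.D K F f) ∉ P.localRing}.Finite := by
  obtain ⟨S, hS⟩ := (Subalgebra.fg_iff_finiteType B).2 hB.finiteType
  refine (S.finite_toSet.biUnion fun b _ => finite_setOf_notMem_localRing (K := K)
    (coord hy (KaehlerDifferential.D K F b))).subset ?_
  rintro P ⟨hP, f, hf, hfP⟩
  by_contra hcon
  simp only [Set.mem_iUnion, not_exists] at hcon
  have hgen : ∀ b ∈ S, coord hy (KaehlerDifferential.D K F b) ∈ P.localRing := fun b hb =>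
    not_not.1 (hcon b hb)
  have hall : ∀ b ∈ B, coord hy (KaehlerDifferential.D K F b) ∈ P.localRing := by
    intro b hb
    rw [← hS] at hb
    induction hb using Algebra.adjoin_induction with
    | mem b hb => exact hgen b hb
    | algebraMap r =>
      rw [Derivation.map_algebraMap, map_zero]
      exact zero_mem _
    | add b c _ _ h1 h2 =>
      rw [map_add, map_add]
      exact add_mem h1 h2
    | mul b c hb hc h1 h2 =>
      rw [coord_derivation_mul]
      exact add_mem (mul_mem (hP _ (hS ▸ hb)) h2) (mul_mem (hP _ (hS ▸ hc)) h1)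
  obtain ⟨b, s, hs, hbs⟩ := hB.exists_mul_eq hP P.localRing_ne_top hf
  refine hfP ?_
  have h0 := coe_ne_zero_of_notMem_centerIdeal hs
  have hd := coord_derivation_mul (K := K) hy f s
  rw [hbs] at hd
  have e : coord hy (KaehlerDifferential.D K F f) = (s : F)⁻¹ *
      (coord hy (KaehlerDifferential.D K F (b : F)) -
        f * coord hy (KaehlerDifferential.D K F (s : F))) := by
    rw [hd]
    field_simp
    ring
  rw [e]
  exact mul_mem (inv_mem_of_notMem_centerIdeal hs)
    (sub_mem (hall _ b.2) (mul_mem hf (hall _ s.2)))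

theorem finite_setOf_coord_notMem {y : F} (hy : ∀ z : F, z ^ p ≠ y) :
    {P : Place K F | ∃ f ∈ P.localRing,
      coord hy (KaehlerDifferential.D K F f) ∉ P.localRing}.Finite := by
  obtain ⟨B, B', hB, hB', h⟩ := exists_isAffineModel_cover K F
  refine ((hB.finite_setOf_coord_notMem hy).union (hB'.finite_setOf_coord_notMem hy)).subset
    fun P hP => ?_
  exact (h P.localRing P.algebraMap_mem).imp (fun h => ⟨h, hP⟩) (fun h => ⟨h, hP⟩)

/-- The poles and zeros of `dy` are bounded: a differential with sufficiently many zeros is a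
multiple of `dy` by a function without poles. -/
theorem exists_divisor_coord_mem {y : F} (hy : ∀ z : F, z ^ p ≠ y) :
    ∃ E : Place K F →₀ ℕ, ∀ A : Divisor K F, (∀ P, (E P : ℤ) ≤ A P) → ∀ ω ∈ diffSpace A,
      ∀ P : Place K F, coord hy ω ∈ P.localRing := by
  classical
  choose t ht using fun P : Place K F => P.exists_isUniformizer
  have hn : ∀ P : Place K F, ∃ n : ℕ,
      P.OrdGE (-n) (coord hy (KaehlerDifferential.D K F (t P))) := by
    intro P
    by_cases h0 : coord hy (KaehlerDifferential.D K F (t P)) = 0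
    · exact ⟨0, h0 ▸ Place.ordGE_zero_right _⟩
    · obtain ⟨n, hn⟩ := P.exists_valuation_eq_exp h0
      refine ⟨n.toNat, ?_⟩
      rw [Place.OrdGE, hn, WithZero.exp_le_exp]
      omega
  choose n hn using hn
  have hfin := finite_setOf_coord_notMem (K := K) hy
  -- `E` bounds the pole of `dt_P/dy` on the finite bad set; elsewhere that function is regular and
  -- `0` suffices.
  refine ⟨Finsupp.onFinset hfin.toFinset (fun P => if P ∈ hfin.toFinset then n P else 0)
    (fun P h => by by_contra hP; simp [hP] at h), fun A hA ω hω P => ?_⟩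
  obtain ⟨f, hf, rfl⟩ := hω P (t P) (ht P)
  have hAP := hA P
  rw [map_smul, smul_eq_mul, ← Place.ordGE_zero_iff]
  rw [Finsupp.onFinset_apply] at hAP
  by_cases hP : P ∈ hfin.toFinset
  · rw [if_pos hP] at hAP
    exact (hf.mul (hn P)).mono (by omega)
  · rw [if_neg hP] at hAP
    have hmem : coord hy (KaehlerDifferential.D K F (t P)) ∈ P.localRing := by
      by_contra hcon
      exact hP (hfin.mem_toFinset.2 ⟨t P, (ht P).mem_localRing, hcon⟩)
    exact (hf.mul (Place.ordGE_zero_iff.2 hmem)).mono (by push_cast at hAP; omega)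

theorem finiteDimensional_diffSpace (p : ℕ) [Fact p.Prime] [CharP F p] (A : Divisor K F) :
    FiniteDimensional K (diffSpace A) := by
  obtain ⟨x, hx⟩ := exists_isSeparating (K := K) (F := F)
  have hy : ∀ z : F, z ^ p ≠ x := hx.pow_ne
  obtain ⟨E, hE⟩ := exists_divisor_coord_mem (K := K) hy
  rw [← Submodule.fg_iff_finiteDimensional]
  -- Adding `|A|` makes `A + |A| ≥ 0`, so the enlarged divisor dominates `E`.
  refine fg_diffSpace_of_add p (E + A.mapRange Int.natAbs rfl) A ?_
  refine Submodule.FG.of_le (Submodule.fg_span_singleton (KaehlerDifferential.D K F x)) ?_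
  intro ω hω
  obtain ⟨a, ha⟩ := exists_algebraMap_eq_of_forall_mem (K := K) (hE _ (fun P => by
    simp only [Finsupp.add_apply, Finsupp.mapRange_apply, Nat.cast_add]
    omega) ω hω)
  rw [Submodule.mem_span_singleton]
  exact ⟨a, by rw [← algebraMap_smul F a, ha, coord_smul_derivation]⟩

end FiniteDimensional

/-! ### Finite fields and a dimension count -/

theorem pow_natCard_eq_self {k K : Type*} [Field k] [Finite k] [Field K] [Algebra k K] {c : K}
    (hc : c ∈ (algebraMap k K).range) : c ^ Nat.card k = c := by
  have := Fintype.ofFinite k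
  obtain ⟨a, rfl⟩ := hc
  rw [← map_pow, Nat.card_eq_fintype_card, FiniteField.pow_card]

/-- `X^q - X` has at most `q` roots in `K`, and the image of `k` already supplies `q`. -/
theorem mem_range_algebraMap_of_pow_natCard {k K : Type*} [Field k] [Finite k] [Field K]
    [Algebra k K] {c : K} (hc : c ^ Nat.card k = c) : c ∈ (algebraMap k K).range := by
  classical
  have := Fintype.ofFinite k
  have hq : 1 < Nat.card k := Finite.one_lt_card
  have h0 := FiniteField.X_pow_card_sub_X_ne_zero K hq
  have hsub : (Finset.univ.image (algebraMap k K)) ⊆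
      (Polynomial.X ^ Nat.card k - Polynomial.X : Polynomial K).roots.toFinset := by
    intro b hb
    obtain ⟨a, -, rfl⟩ := Finset.mem_image.1 hb
    rw [Multiset.mem_toFinset, Polynomial.mem_roots h0]
    rw [Polynomial.IsRoot, Polynomial.eval_sub, Polynomial.eval_pow, Polynomial.eval_X,
      pow_natCard_eq_self ⟨a, rfl⟩, sub_self]
  have heq := Finset.eq_of_subset_of_card_le hsub (by
    rw [Finset.card_image_of_injective _ (algebraMap k K).injective, Finset.card_univ,
      ← Nat.card_eq_fintype_card]
    refine (Multiset.toFinset_card_le _).trans ((Polynomial.card_roots' _).trans ?_)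
    rw [FiniteField.X_pow_card_sub_X_natDegree_eq K hq])
  have hmem : c ∈ (Polynomial.X ^ Nat.card k - Polynomial.X : Polynomial K).roots.toFinset := by
    rw [Multiset.mem_toFinset, Polynomial.mem_roots h0]
    rw [Polynomial.IsRoot, Polynomial.eval_sub, Polynomial.eval_pow, Polynomial.eval_X, hc,
      sub_self]
  rw [← heq] at hmem
  obtain ⟨a, -, ha⟩ := Finset.mem_image.1 hmem
  exact ⟨a, ha⟩

/-- The quotient is an image of `X / ker φ`, which embeds in `N`. -/
theorem finrank_quotient_submoduleOf_le {k X M N : Type*} [Field k] [AddCommGroup X] [Module k X]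
    [AddCommGroup M] [Module k M] [AddCommGroup N] [Module k N] [FiniteDimensional k N]
    (f : X →ₗ[k] M) (φ : X →ₗ[k] N) {C S : Submodule k M} (hf : ∀ x, f x ∈ S)
    (hS : ∀ c ∈ S, ∃ x, f x = c) (hker : ∀ x, φ x = 0 → f x ∈ C) :
    Module.finrank k (S ⧸ C.submoduleOf S) ≤ Module.finrank k N := by
  let g : X →ₗ[k] S ⧸ C.submoduleOf S := (C.submoduleOf S).mkQ ∘ₗ f.codRestrict S hf
  have hg : LinearMap.ker φ ≤ LinearMap.ker g := by
    intro x hx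
    rw [LinearMap.mem_ker, LinearMap.comp_apply, Submodule.mkQ_apply,
      Submodule.Quotient.mk_eq_zero]
    exact hker x hx
  have hsurj : Function.Surjective ((LinearMap.ker φ).liftQ g hg) := by
    intro c
    obtain ⟨c, rfl⟩ := Submodule.mkQ_surjective _ c
    obtain ⟨x, hx⟩ := hS c c.2
    refine ⟨Submodule.Quotient.mk x, ?_⟩
    rw [Submodule.liftQ_apply]
    exact congrArg _ (Subtype.ext hx)
  have : FiniteDimensional k (X ⧸ LinearMap.ker φ) := φ.quotKerEquivRange.symm.finiteDimensional
  exact (LinearMap.finrank_le_finrank_of_surjective hsurj).trans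
    (φ.quotKerEquivRange.finrank_eq.trans_le (Submodule.finrank_le _))

/-! ### Comparison of the two codes -/

section Codes

variable {K F : Type*} [Field K] [Field F] [Algebra K F] {n : ℕ} {P : Fin n → Place K F}

theorem pointDivisor_apply_self (hP : Function.Injective P) (i : Fin n) :
    pointDivisor P (P i) = 1 := by
  classical
  simp [pointDivisor, Finsupp.finsetSum_apply, Finsupp.single_apply, hP.eq_iff]

theorem pointDivisor_apply_of_notMem {Q : Place K F} (hQ : Q ∉ Set.range P) :
    pointDivisor P Q = 0 := by
  classical
  rw [pointDivisor, Finsupp.finsetSum_apply]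
  refine Finset.sum_eq_zero fun i _ => ?_
  rw [Finsupp.single_apply, if_neg fun h => hQ ⟨i, h⟩]

theorem diffOrdGE_neg_one_of_mem {G : Divisor K F} (hP : Function.Injective P)
    (hG : ∀ i, G (P i) = 0) {ω : Ω[F⁄K]} (hω : ω ∈ diffSpace (G - pointDivisor P)) (i : Fin n) :
    (P i).DiffOrdGE (-1) ω := by
  have := hω (P i)
  rwa [Finsupp.sub_apply, hG i, pointDivisor_apply_self hP, zero_sub] at this

variable {k : Type*} [Field k] [Finite k] [Algebra k K] {p s : ℕ} [Fact p.Prime] [CharP F p]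
  [Finite K] [IsCurveFunctionField K F]

/-- If `ω ∈ Ω(G - D)` has its residues at `D` in `𝔽_q`, then `𝒞_q(ω) - ω ∈ Ω(G₁)`. -/
theorem cartierIter_sub_mem_diffSpace (hq : Nat.card k = p ^ s) (hP : Function.Injective P)
    (hrat : ∀ i, (P i).IsRational) {G G₁ : Divisor K F} (hG : ∀ i, G (P i) = 0)
    (hqG₁ : Nat.card k • G₁ ≤ G) (hG₁ : G₁ ≤ G) {ω η : Ω[F⁄K]} {c : Fin n → K}
    (hω : ω ∈ diffSpace (G - pointDivisor P)) (hc : ∀ i, c i ∈ (algebraMap k K).range)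
    (hres : ∀ i, (P i).HasResidue ω (c i)) (hC : IsCartierIter p s ω η) :
    η - ω ∈ diffSpace G₁ := by
  intro Q
  by_cases hQ : Q ∈ Set.range P
  · obtain ⟨i, rfl⟩ := hQ
    obtain ⟨t, ht⟩ := (P i).exists_isUniformizer
    have hω1 := diffOrdGE_neg_one_of_mem hP hG hω i
    have hη1 := hω1.cartierIter_neg_one hC
    have hωc := (hres i).hasSimpleResidue p hω1 ht
    obtain ⟨b, hb⟩ := hη1.exists_hasSimpleResidue (hrat i) ht
    have hbc : c i = b ^ p ^ s := hωc.unique p ht (hb.cartierIter ht hω1 hC)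
    have hK : CharP K p := charP_of_charP_algebra K (F := F) p
    have hbc' : b = c i := by
      have h := pow_natCard_eq_self (hc i)
      rw [hq] at h
      -- Here `b^q = c i = (c i)^q`, so the two residues agree and the polar parts cancel below.
      exact (iterateFrobenius K p s).injective (hbc.symm.trans h.symm)
    subst hbc'
    obtain ⟨r, hr, h1⟩ := hωc
    obtain ⟨r', hr', h2⟩ := hb
    have e : η - ω = (r' - r) • KaehlerDifferential.D K F t := by
      rw [h1, h2, ← sub_smul, add_sub_add_left_eq_sub]
    rw [e]
    refine ht.diffOrdGE_smul p ((Place.ordGE_zero_iff.2 (sub_mem hr' hr)).mono ?_)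
    exact (hG₁ (P i)).trans (hG i).le
  · have hωQ := hω Q
    rw [Finsupp.sub_apply, pointDivisor_apply_of_notMem hQ, sub_zero] at hωQ
    refine Place.DiffOrdGE.sub (Place.DiffOrdGE.cartierIter (s := s) (hωQ.mono ?_) hC)
      (hωQ.mono (hG₁ Q))
    have h := hqG₁ Q
    rw [Finsupp.smul_apply, nsmul_eq_mul, hq] at h
    exact_mod_cast h

theorem cartierCode_le_subfieldSubcode (hq : Nat.card k = p ^ s) (hP : Function.Injective P)
    {G : Divisor K F} (hG : ∀ i, G (P i) = 0) :
    cartierCode k hq P G ≤ subfieldSubcode k (residueCode P G) := by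
  rintro c ⟨ω, hω, hC, hres⟩
  refine ⟨⟨ω, hω, hres⟩, fun i => mem_range_algebraMap_of_pow_natCard ?_⟩
  obtain ⟨t, ht⟩ := (P i).exists_isUniformizer
  have hω1 := diffOrdGE_neg_one_of_mem hP hG hω i
  have h := (hres i).hasSimpleResidue p hω1 ht
  rw [hq]
  exact (h.cartierIter ht hω1 hC).unique p ht h

theorem finrank_quotient_cartierCode_le [FiniteDimensional k K] (hq : Nat.card k = p ^ s)
    (hP : Function.Injective P) (hrat : ∀ i, (P i).IsRational) {G G₁ : Divisor K F}
    (hG : ∀ i, G (P i) = 0) (hqG₁ : Nat.card k • G₁ ≤ G) (hG₁ : G₁ ≤ G) :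
    Module.finrank k (subfieldSubcode k (residueCode P G) ⧸
      (cartierCode k hq P G).submoduleOf (subfieldSubcode k (residueCode P G))) ≤
      Module.finrank k K * h1 G₁ := by
  let _ : Module k Ω[F⁄K] := Module.compHom _ (algebraMap k K)
  have : IsScalarTower k K Ω[F⁄K] := ⟨fun a b ω => by
    rw [Algebra.smul_def, mul_smul]
    rfl⟩
  have := finiteDimensional_diffSpace p G₁
  have : FiniteDimensional k (diffSpace G₁) := Module.Finite.trans K _
  rw [h1, Module.finrank_mul_finrank k K (diffSpace G₁)]
  -- Residues are given by a relation, so the domain consists of pairs of a form and its residue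
  -- vector.
  let W : Submodule k (Ω[F⁄K] × (Fin n → K)) :=
    { carrier := {w | w.1 ∈ diffSpace (G - pointDivisor P) ∧
        (∀ i, w.2 i ∈ (algebraMap k K).range) ∧ ∀ i, (P i).HasResidue w.1 (w.2 i)}
      add_mem' := fun h h' => ⟨add_mem h.1 h'.1, fun i => add_mem (h.2.1 i) (h'.2.1 i),
        fun i => (h.2.2 i).add (h'.2.2 i)⟩
      zero_mem' := ⟨zero_mem _, fun _ => zero_mem _, fun _ => Place.HasResidue.zero _⟩
      smul_mem' := fun a w h => ⟨Submodule.smul_mem _ (algebraMap k K a) h.1, fun i => by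
          rw [Prod.smul_snd, Pi.smul_apply, Algebra.smul_def]
          exact mul_mem ⟨a, rfl⟩ (h.2.1 i), fun i => by
          rw [Prod.smul_snd, Pi.smul_apply, Algebra.smul_def]
          exact (h.2.2 i).smul _⟩ }
  choose C hC using fun ω : Ω[F⁄K] => exists_isCartierIter p s ω
  have hadd : ∀ ω η, C (ω + η) = C ω + C η := fun ω η => (hC _).unique ((hC ω).add (hC η))
  -- `𝒞_q` is only `q⁻¹`-semilinear over `K`, but `a^q = a` on `k`.
  have hsmul : ∀ (a : k) ω, C (a • ω) = a • C ω := fun a ω => by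
    have h := (hC ω).smul (algebraMap k K a)
    rw [← hq, pow_natCard_eq_self ⟨a, rfl⟩] at h
    exact (hC _).unique h
  let φ : W →ₗ[k] diffSpace G₁ :=
    { toFun := fun w => ⟨C w.1.1 - w.1.1, cartierIter_sub_mem_diffSpace hq hP hrat hG hqG₁ hG₁
        w.2.1 w.2.2.1 w.2.2.2 (hC _)⟩
      map_add' := fun w w' => Subtype.ext (by
        change C (w.1.1 + w'.1.1) - (w.1.1 + w'.1.1) = C w.1.1 - w.1.1 + (C w'.1.1 - w'.1.1)
        rw [hadd]
        abel)
      map_smul' := fun a w => Subtype.ext (by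
        change C (a • w.1.1) - a • w.1.1 = a • (C w.1.1 - w.1.1)
        rw [hsmul, smul_sub]) }
  refine finrank_quotient_submoduleOf_le (LinearMap.snd k _ _ ∘ₗ W.subtype) φ ?_ ?_ ?_
  · exact fun w => ⟨⟨w.1.1, w.2.1, w.2.2.2⟩, w.2.2.1⟩
  · rintro c ⟨⟨ω, hω, hres⟩, hc⟩
    exact ⟨⟨(ω, c), hω, hc, hres⟩, rfl⟩
  · intro w hw
    have hw' : C w.1.1 = w.1.1 := sub_eq_zero.1 (congrArg Subtype.val hw)
    have hCw := hC w.1.1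
    rw [hw'] at hCw
    exact ⟨w.1.1, w.2.1, hCw, w.2.2.2⟩

end Codes

end AGCode

theorem mainTheorem3 {k K F : Type*} [Field k] [Finite k] [Field K] [Algebra k K]
    [FiniteDimensional k K] [Field F] [Algebra K F] [AGCode.IsCurveFunctionField K F]
    {p s ℓ : ℕ} [Fact p.Prime] [CharP F p] (hq : Nat.card k = p ^ s)
    (hℓ : Module.finrank k K = ℓ)
    {n : ℕ} (P : Fin n → AGCode.Place K F) (hP : Function.Injective P)
    (hrat : ∀ i, (P i).IsRational)
    (G G₁ : AGCode.Divisor K F) (hG : ∀ i, G (P i) = 0)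
    (hqG₁ : Nat.card k • G₁ ≤ G) (hG₁ : G₁ ≤ G) :
    FiniteDimensional K (AGCode.diffSpace G₁) ∧
    AGCode.cartierCode k hq P G ≤ AGCode.subfieldSubcode k (AGCode.residueCode P G) ∧
    Module.finrank k
        (AGCode.subfieldSubcode k (AGCode.residueCode P G) ⧸
          (AGCode.cartierCode k hq P G).submoduleOf
            (AGCode.subfieldSubcode k (AGCode.residueCode P G))) ≤
      ℓ * AGCode.h1 G₁ ∧
    (AGCode.h1 G₁ = 0 →
      AGCode.subfieldSubcode k (AGCode.residueCode P G) = AGCode.cartierCode k hq P G) := by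
  have : Finite K := Module.finite_of_finite k
  have hle := AGCode.cartierCode_le_subfieldSubcode hq hP hG
  have hrank := AGCode.finrank_quotient_cartierCode_le hq hP hrat hG hqG₁ hG₁
  refine ⟨AGCode.finiteDimensional_diffSpace p G₁, hle, hℓ ▸ hrank, fun h0 => ?_⟩
  rw [h0, mul_zero, Nat.le_zero] at hrank
  refine le_antisymm ?_ hle
  -- The quotient is finite-dimensional, so rank zero does mean that it is trivial.
  have hsub := Module.finrank_zero_iff.1 hrank
  exact Submodule.submoduleOf_eq_top.1 (Submodule.Quotient.subsingleton_iff.1 hsub)
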